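/- Let $s\in[-\frac12,1]$, $s\neq 0$, be fixed. For $\delta>1$ let $$S_\delta=\{x_1^2+(x_2-\delta)^2<1\}\cup\{x_1^2+(x_2+\delta)^2<1\}\cup\{|x_1|<1,\ |x_2|\le\delta\}\subset\mathbb{R}^2$$ be the stadium, and let $$M_\delta=S_\delta\setminus\left(\{x_1^2+(x_2-\delta)^2\le\tfrac12\}\cup\{x_1^2+(x_2+\delta)^2\le\tfrac12\}\right)$$ be the stadium with two holes, whose outer boundary is $\partial S_\delta$. Let $\tau_\delta:\partial S_\delta\to\mathbb{S}^1\subset\mathbb{R}^2$ be the unit tangent of $\partial S_\delta$, oriented clockwise or anticlockwise (one of the two is chosen). For a unit vector $m=(m_1,m_2)$ put $P(m)=s\left((m_1,m_2,0)\otimes(m_1,m_2,0)-\frac13\mathrm{Id}\right)$, and let $\mathcal{Q}_2=\{P(m):m\in\mathbb{S}^1\}\subset\mathbb{R}^{3\times3}$. Consider the class $\mathcal{A}_\delta$ of line fields $Q\in W^{1,2}(M_\delta;\mathcal{Q}_2)$ with trace $Q=P(\tau_\delta)$ on $\partial S_\delta$, and the class $\mathcal{B}_\delta$ of vector fields $n\in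 W^{1,2}(M_\delta;\mathbb{S}^1)$ with trace $n=\tau_\delta$ on $\partial S_\delta$, with the energies $$E_\delta(Q)=\int_{M_\delta}|\nabla Q|^2\,dx\quad(Q\in\mathcal{A}_\delta),\qquad F_\delta(n)=2s^2\int_{M_\delta}|\nabla n|^2\,dx\quad(n\in\mathcal{B}_\delta).$$ Then there exists $\delta_0>1$ such that for every $\delta>\delta_0$, and for either orientation of $\tau_\delta$, both classes are non-empty, $$\inf_{\mathcal{A}_\delta}E_\delta<\inf_{\mathcal{B}_\delta}F_\delta,$$ and hence $E_\delta(\bar Q_\delta)<F_\delta(\bar n_\delta)$ for any global minimizer $\bar Q_\delta$ of $E_\delta$ in $\mathcal{A}_\delta$ and any global minimizer $\bar n_\delta$ of $F_\delta$ in $\mathcal{B}_\delta$. -/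

import Mathlib

open MeasureTheory Filter Topology
open scoped ContDiff

noncomputable section

namespace LineField

/-- The plane `ℝ²` with its Euclidean norm; `x 0` is the coordinate `x₁`, `x 1` is `x₂`. -/
abbrev Plane := EuclideanSpace ℝ (Fin 2)

/-! ### Sobolev functions -/

/-- `g` is the weak partial derivative `∂u/∂xᵢ` in the open set `U`. -/
def IsWeakPartial (U : Set Plane) (i : Fin 2) (u g : Plane → ℝ) : Prop :=
  LocallyIntegrableOn u U ∧ LocallyIntegrableOn g U ∧
    ∀ φ : Plane → ℝ, ContDiff ℝ ∞ φ → HasCompactSupport φ → tsupport φ ⊆ U →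
      ∫ x in U, u x * fderiv ℝ φ x (EuclideanSpace.single i 1) = -∫ x in U, g x * φ x

open Classical in
/-- The weak partial derivative (unique almost everywhere in `U`), if there is one. -/
def weakPartial (U : Set Plane) (i : Fin 2) (u : Plane → ℝ) : Plane → ℝ :=
  if h : ∃ g, IsWeakPartial U i u g then h.choose else 0

/-- `u ∈ W^{1,2}(U)`. -/
def MemW12 (U : Set Plane) (u : Plane → ℝ) : Prop :=
  MemLp u 2 (volume.restrict U) ∧
    ∀ i, ∃ g, IsWeakPartial U i u g ∧ MemLp g 2 (volume.restrict U)

/-- The Dirichlet integral `∫_U |∇f|² dx` of a field with finitely many real components. -/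
def dirichlet {ι : Type*} [Fintype ι] (U : Set Plane) (f : Plane → ι → ℝ) : ℝ :=
  ∫ x in U, ∑ a, ∑ i, (weakPartial U i (fun y => f y a) x) ^ 2

/-- `v k → u` in `W^{1,2}(U)`. -/
def TendstoW12 (U : Set Plane) (v : ℕ → Plane → ℝ) (u : Plane → ℝ) : Prop :=
  Tendsto (fun k => eLpNorm (v k - u) 2 (volume.restrict U)) atTop (𝓝 0) ∧
    ∀ i, Tendsto (fun k => eLpNorm (weakPartial U i (v k - u)) 2 (volume.restrict U))
      atTop (𝓝 0)

/-- The trace of `u ∈ W^{1,2}(U)` on the part `Γ` of the boundary of `U` is `φ`. The trace operator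
is the continuous extension to `W^{1,2}(U)` of the restriction `v ↦ v|_Γ`, with values in
`L²(Γ)` for the one-dimensional Hausdorff measure, defined for `v ∈ W^{1,2}(U) ∩ C(closure U)`. -/
def HasTrace (U Γ : Set Plane) (u φ : Plane → ℝ) : Prop :=
  ∃ v : ℕ → Plane → ℝ, (∀ k, MemW12 U (v k) ∧ ContinuousOn (v k) (closure U)) ∧
    TendstoW12 U v u ∧
    Tendsto (fun k => eLpNorm (v k - φ) 2 ((Measure.hausdorffMeasure 1).restrict Γ))
      atTop (𝓝 0)

/-! ### The stadium with two holes -/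

/-- The open disc `M₁`. -/
def M₁ (δ : ℝ) : Set Plane := {x | x 0 ^ 2 + (x 1 - δ) ^ 2 < 1}

/-- The open disc `M₂`. -/
def M₂ (δ : ℝ) : Set Plane := {x | x 0 ^ 2 + (x 1 + δ) ^ 2 < 1}

/-- The rectangle `M₃`. -/
def M₃ (δ : ℝ) : Set Plane := {x | |x 0| < 1 ∧ |x 1| ≤ δ}

/-- The hole `M₄`. -/
def M₄ (δ : ℝ) : Set Plane := {x | x 0 ^ 2 + (x 1 - δ) ^ 2 ≤ 1 / 2}

/-- The hole `M₅`. -/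
def M₅ (δ : ℝ) : Set Plane := {x | x 0 ^ 2 + (x 1 + δ) ^ 2 ≤ 1 / 2}

/-- The stadium without holes. -/
def fullStadium (δ : ℝ) : Set Plane := M₁ δ ∪ M₂ δ ∪ M₃ δ

/-- The domain `M_δ`. -/
def stadium (δ : ℝ) : Set Plane := fullStadium δ \ (M₄ δ ∪ M₅ δ)

/-- The outer boundary of `M_δ`. -/
def outerBoundary (δ : ℝ) : Set Plane := frontier (fullStadium δ)

/-- On the outer boundary, the clockwise unit tangent: the point of the segment `{0} × [-δ, δ]`
nearest to `x` is `(0, max (-δ) (min δ x₂))`, the difference of `x` and this point is the outer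
unit normal `(ν₁, ν₂)`, and the tangent is `(ν₂, -ν₁)`. So it is `(x₂ - δ, -x₁)` on the upper
arc, `(x₂ + δ, -x₁)` on the lower arc, `(0, -1)` on the right side, `(0, 1)` on the left side. -/
def clockwiseTangent (δ : ℝ) (x : Plane) : Plane :=
  !₂[x 1 - max (-δ) (min δ (x 1)), -x 0]

/-! ### Line fields, vector fields and their energies -/

/-- The matrix `s (m ⊗ m - Id / 3)` with `m = (n₁, n₂, 0)`. -/
def lineTensor (s : ℝ) (n : Plane) : Matrix (Fin 3) (Fin 3) ℝ :=
  s • (Matrix.vecMulVec ![n 0, n 1, 0] ![n 0, n 1, 0] - (1 / 3 : ℝ) • 1)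

/-- The set `𝒬₂` of planar line tensors. -/
def Q₂ (s : ℝ) : Set (Matrix (Fin 3) (Fin 3) ℝ) := {Q | ∃ n : Plane, ‖n‖ = 1 ∧ Q = lineTensor s n}

/-- The fields `Q ∈ W^{1,2}(M_δ; 𝒬₂)` whose trace on the outer boundary is the tangent
line field. -/
def tangentLineFields (s δ : ℝ) : Set (Plane → Matrix (Fin 3) (Fin 3) ℝ) :=
  {Q | (∀ a b, MemW12 (stadium δ) fun x => Q x a b) ∧
    (∀ᵐ x ∂volume.restrict (stadium δ), Q x ∈ Q₂ s) ∧
    ∀ a b, HasTrace (stadium δ) (outerBoundary δ) (fun x => Q x a b)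
      (fun x => lineTensor s (clockwiseTangent δ x) a b)}

/-- The fields `n ∈ W^{1,2}(M_δ; 𝕊¹)` whose trace on the outer boundary is `σ` times the clockwise
unit tangent: `σ = 1` is the clockwise and `σ = -1` the anticlockwise orientation. -/
def tangentVectorFields (δ σ : ℝ) : Set (Plane → Plane) :=
  {n | (∀ a, MemW12 (stadium δ) fun x => n x a) ∧
    (∀ᵐ x ∂volume.restrict (stadium δ), ‖n x‖ = 1) ∧
    ∀ a, HasTrace (stadium δ) (outerBoundary δ) (fun x => n x a)
      (fun x => σ * clockwiseTangent δ x a)}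

/-- `∫_{M_δ} |∇Q|² dx`, with the Frobenius norm. -/
def lineEnergy (δ : ℝ) (Q : Plane → Matrix (Fin 3) (Fin 3) ℝ) : ℝ :=
  dirichlet (stadium δ) fun x (p : Fin 3 × Fin 3) => Q x p.1 p.2

/-- `2 s² ∫_{M_δ} |∇n|² dx`. -/
def vectorEnergy (s δ : ℝ) (n : Plane → Plane) : ℝ :=
  2 * s ^ 2 * dirichlet (stadium δ) fun x (a : Fin 2) => n x a

end LineField

end

namespace LineField

/-! ### Weak partial derivatives -/

/-! The tangent points down one straight side of the stadium and up the other. As lines these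
boundary values agree, since $P(m)=P(-m)$; as vectors they are opposite. The line energy therefore
stays bounded as $\delta\to\infty$, while the vector energy grows at least linearly in $\delta$.

Upper bound: the line field that is tangential around each end of the segment
$\{0\}\times[-\delta,\delta]$ is vertical on the lines $x_2=\pm\delta$, so it continues as a
constant through the strip between them. Its singularities lie in the holes, and its gradient lives
on two caps whose size and Lipschitz bounds do not depend on $\delta$ (`tangentLineField_mem`,
`exists_lineEnergy_tangentLineField_le`).

Lower bound: on each horizontal line away from the caps, $n_2$ changes by $-2\sigma$ over width 2,
which costs Dirichlet energy at least 2. For Sobolev fields with traces this is done weakly: the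
Gauss-Green formula tested with a cutoff $\psi(x_2)$ gives
$\int\partial_1n_2\,\psi=-2\sigma\int\psi$ (`integral_rect_of_hasTrace`), and completing a square
yields `dirichlet_tangentVectorFields_ge`. The formula rests on a one-dimensional fundamental
theorem of calculus, `integral_weakDeriv_eq_sub`, applied to slice integrals. -/

theorem integrable_mul_of_tsupport_subset {U : Set Plane} {g φ : Plane → ℝ}
    (hg : LocallyIntegrableOn g U) (hφ : Continuous φ) (hc : HasCompactSupport φ)
    (hs : tsupport φ ⊆ U) : Integrable (fun x => g x * φ x) := by
  have h1 : IntegrableOn g (tsupport φ) := hg.integrableOn_compact_subset hs hc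
  have h2 : IntegrableOn (fun x => g x * φ x) (tsupport φ) :=
    h1.mul_continuousOn hφ.continuousOn hc
  refine (integrableOn_iff_integrable_of_support_subset ?_).1 h2
  intro x hx
  exact subset_tsupport φ (right_ne_zero_of_mul hx)

/-- The fundamental lemma of the calculus of variations. It makes the energy independent of the
choice hidden in `weakPartial`. -/
theorem IsWeakPartial.ae_eq {U : Set Plane} (hU : IsOpen U) {i : Fin 2} {u g g' : Plane → ℝ}
    (h : IsWeakPartial U i u g) (h' : IsWeakPartial U i u g') :
    g =ᵐ[volume.restrict U] g' := by
  have key : ∀ᵐ x ∂(volume : Measure Plane), x ∈ U → (g - g') x = 0 := by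
    refine hU.ae_eq_zero_of_integral_contDiff_smul_eq_zero (h.2.1.sub h'.2.1) ?_
    intro φ hφ hc hs
    have e1 := h.2.2 φ hφ hc hs
    have e2 := h'.2.2 φ hφ hc hs
    have i1 := integrable_mul_of_tsupport_subset h.2.1 hφ.continuous hc hs
    have i2 := integrable_mul_of_tsupport_subset h'.2.1 hφ.continuous hc hs
    have e3 : ∫ x in U, (g x * φ x - g' x * φ x) = 0 := by
      rw [integral_sub i1.integrableOn i2.integrableOn]
      linarith
    rw [setIntegral_eq_integral_of_forall_compl_eq_zero] at e3
    · rw [← e3]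
      congr 1
      ext x
      simp only [Pi.sub_apply, smul_eq_mul]
      ring
    · intro x hx
      have : φ x = 0 := image_eq_zero_of_notMem_tsupport fun h => hx (hs h)
      simp [this]
  rw [Filter.EventuallyEq, ae_restrict_iff' hU.measurableSet]
  filter_upwards [key] with x hx hxU
  exact sub_eq_zero.1 (hx hxU)

theorem isWeakPartial_weakPartial {U : Set Plane} {i : Fin 2} {u g : Plane → ℝ}
    (h : IsWeakPartial U i u g) : IsWeakPartial U i u (weakPartial U i u) := by
  have hex : ∃ g, IsWeakPartial U i u g := ⟨g, h⟩
  rw [weakPartial, dif_pos hex]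
  exact hex.choose_spec

theorem IsWeakPartial.weakPartial_ae_eq {U : Set Plane} (hU : IsOpen U) {i : Fin 2}
    {u g : Plane → ℝ} (h : IsWeakPartial U i u g) :
    weakPartial U i u =ᵐ[volume.restrict U] g :=
  (isWeakPartial_weakPartial h).ae_eq hU h

theorem IsWeakPartial.add {U : Set Plane} {i : Fin 2} {u g u' g' : Plane → ℝ}
    (h : IsWeakPartial U i u g) (h' : IsWeakPartial U i u' g') :
    IsWeakPartial U i (u + u') (g + g') := by
  refine ⟨h.1.add h'.1, h.2.1.add h'.2.1, fun φ hφ hc hs => ?_⟩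
  have hd : Continuous fun x => fderiv ℝ φ x (EuclideanSpace.single i 1) :=
    (hφ.continuous_fderiv (by simp)).clm_apply continuous_const
  have hdc : HasCompactSupport fun x => fderiv ℝ φ x (EuclideanSpace.single i 1) :=
    hc.fderiv_apply ℝ _
  have hds : tsupport (fun x => fderiv ℝ φ x (EuclideanSpace.single i 1)) ⊆ U :=
    (tsupport_fderiv_apply_subset ℝ _).trans hs
  have e1 := h.2.2 φ hφ hc hs
  have e2 := h'.2.2 φ hφ hc hs
  simp only [Pi.add_apply, add_mul]
  rw [integral_add (integrable_mul_of_tsupport_subset h.1 hd hdc hds).integrableOn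
      (integrable_mul_of_tsupport_subset h'.1 hd hdc hds).integrableOn,
    integral_add (integrable_mul_of_tsupport_subset h.2.1 hφ.continuous hc hs).integrableOn
      (integrable_mul_of_tsupport_subset h'.2.1 hφ.continuous hc hs).integrableOn, e1, e2]
  ring

theorem IsWeakPartial.neg {U : Set Plane} {i : Fin 2} {u g : Plane → ℝ}
    (h : IsWeakPartial U i u g) : IsWeakPartial U i (-u) (-g) := by
  refine ⟨h.1.neg, h.2.1.neg, fun φ hφ hc hs => ?_⟩
  have e1 := h.2.2 φ hφ hc hs
  simp only [Pi.neg_apply, neg_mul, integral_neg, e1]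

theorem isWeakPartial_zero (U : Set Plane) (i : Fin 2) : IsWeakPartial U i 0 0 :=
  ⟨locallyIntegrableOn_zero, locallyIntegrableOn_zero, fun φ _ _ _ => by simp⟩

theorem MemW12.isWeakPartial {U : Set Plane} {u : Plane → ℝ} (h : MemW12 U u) (i : Fin 2) :
    IsWeakPartial U i u (weakPartial U i u) := by
  obtain ⟨g, hg, -⟩ := h.2 i
  exact isWeakPartial_weakPartial hg

theorem MemW12.memLp_weakPartial {U : Set Plane} (hU : IsOpen U) {u : Plane → ℝ}
    (h : MemW12 U u) (i : Fin 2) : MemLp (weakPartial U i u) 2 (volume.restrict U) := by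
  obtain ⟨g, hg, hg2⟩ := h.2 i
  exact hg2.ae_eq (hg.weakPartial_ae_eq hU).symm

/-! ### Lipschitz functions -/

theorem memLp_of_bound_of_measure_ne_top {U : Set Plane} (hU : volume U ≠ ⊤) {u : Plane → ℝ}
    (hu : AEStronglyMeasurable u) {B : ℝ} (hB : ∀ x, |u x| ≤ B) :
    MemLp u 2 (volume.restrict U) := by
  have : IsFiniteMeasure (volume.restrict U) := ⟨by simpa using hU.lt_top⟩
  exact MemLp.of_bound hu.restrict B (.of_forall hB)

theorem abs_lineDeriv_single_le {C : NNReal} {u : Plane → ℝ} (hu : LipschitzWith C u)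
    (i : Fin 2) (x : Plane) : |lineDeriv ℝ u x (EuclideanSpace.single i 1)| ≤ C := by
  have := norm_lineDeriv_le_of_lipschitz (𝕜 := ℝ) (x₀ := x) (v := EuclideanSpace.single i 1) hu
  simpa using this

/-- Test functions are themselves Lipschitz, so integration by parts for a pair of Lipschitz
functions on the whole plane applies; the support condition reduces both integrals to `U`. -/
theorem isWeakPartial_lineDeriv {U : Set Plane} {C : NNReal}
    {u : Plane → ℝ} (hu : LipschitzWith C u) (i : Fin 2) :
    IsWeakPartial U i u fun x => lineDeriv ℝ u x (EuclideanSpace.single i 1) := by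
  refine ⟨hu.continuous.locallyIntegrable.locallyIntegrableOn U,
    (hu.locallyIntegrable_lineDeriv _).locallyIntegrableOn U, fun φ hφ hc hs => ?_⟩
  obtain ⟨D, hD⟩ := ContDiff.lipschitzWith_of_hasCompactSupport hc hφ (by simp)
  have h := hu.integral_lineDeriv_mul_eq hD hc (EuclideanSpace.single i (1 : ℝ))
    (μ := (volume : Measure Plane))
  have hz : ∀ x, x ∉ U → φ x = 0 := fun x hx =>
    image_eq_zero_of_notMem_tsupport fun h => hx (hs h)
  have hz' : ∀ x, x ∉ U → fderiv ℝ φ x = 0 := fun x hx =>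
    image_eq_zero_of_notMem_tsupport fun h => hx (hs (tsupport_fderiv_subset ℝ h))
  rw [setIntegral_eq_integral_of_forall_compl_eq_zero fun x hx => by simp [hz' x hx],
    setIntegral_eq_integral_of_forall_compl_eq_zero fun x hx => by simp [hz x hx], h,
    ← integral_neg]
  congr 1
  ext x
  rw [((hφ.differentiable (by simp)) x).lineDeriv_eq_fderiv, map_neg]
  ring

theorem memW12_of_lipschitzWith {U : Set Plane} (hU : volume U ≠ ⊤) {C : NNReal}
    {u : Plane → ℝ} (hu : LipschitzWith C u) {B : ℝ} (hB : ∀ x, |u x| ≤ B) : MemW12 U u :=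
  ⟨memLp_of_bound_of_measure_ne_top hU hu.continuous.aestronglyMeasurable hB, fun i =>
    ⟨_, isWeakPartial_lineDeriv hu i, memLp_of_bound_of_measure_ne_top hU
      (aestronglyMeasurable_lineDeriv hu.continuous _) (abs_lineDeriv_single_le hu i)⟩⟩

/-- The constant sequence is an admissible approximation. -/
theorem hasTrace_of_continuous {U Γ : Set Plane} (hU : IsOpen U) (hΓ : MeasurableSet Γ)
    {u φ : Plane → ℝ} (hu : MemW12 U u) (hc : Continuous u) (h : ∀ x ∈ Γ, u x = φ x) :
    HasTrace U Γ u φ := by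
  refine ⟨fun _ => u, fun _ => ⟨hu, hc.continuousOn⟩, ⟨by simp, fun i => ?_⟩, ?_⟩
  · have h0 := (isWeakPartial_zero U i).weakPartial_ae_eq hU
    simp only [sub_self]
    rw [eLpNorm_congr_ae h0]
    simp
  · have h0 : (u - φ) =ᵐ[(Measure.hausdorffMeasure 1).restrict Γ] 0 := by
      rw [Filter.EventuallyEq, ae_restrict_iff' hΓ]
      exact .of_forall fun x hx => by simp [h x hx]
    beta_reduce
    rw [eLpNorm_congr_ae h0]
    simp

/-! ### Lipschitz estimates -/

section Lipschitz

variable {α : Type*} [PseudoMetricSpace α] {f g m : α → ℝ} {C D : NNReal}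

/-- Since the quotient is bounded by 1, no bound on `f` itself enters the constant; this keeps the
estimates uniform in $\delta$. -/
theorem lipschitzWith_div (hf : LipschitzWith C f) (hm : LipschitzWith D m) {c : NNReal}
    (hc : 0 < c) (hcm : ∀ x, c ≤ m x) (hfm : ∀ x, |f x| ≤ m x) :
    LipschitzWith ((C + D) / c) fun x => f x / m x := by
  refine LipschitzWith.of_dist_le_mul fun x y => ?_
  have hc' : (0 : ℝ) < c := hc
  have hx : 0 < m x := hc'.trans_le (hcm x)
  have hy : 0 < m y := hc'.trans_le (hcm y)
  have h1 := hf.dist_le_mul x y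
  have h2 := hm.dist_le_mul x y
  rw [Real.dist_eq] at h1 h2 ⊢
  have e : f x / m x - f y / m y = ((f x - f y) - f y / m y * (m x - m y)) / m x := by
    field_simp
    ring
  have h3 : |f y / m y| ≤ 1 := by
    rw [abs_div, abs_of_pos hy]
    exact div_le_one_of_le₀ (hfm y) hy.le
  have h4 : |(f x - f y) - f y / m y * (m x - m y)| ≤ C * dist x y + D * dist x y := by
    refine (abs_sub _ _).trans (add_le_add h1 ?_)
    rw [abs_mul]
    exact (mul_le_of_le_one_left (abs_nonneg _) h3).trans h2
  rw [e, abs_div, abs_of_pos hx]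
  have h0 : 0 ≤ C * dist x y + D * dist x y := by positivity
  calc _ ≤ (C * dist x y + D * dist x y) / m x := by gcongr
    _ ≤ (C * dist x y + D * dist x y) / c := by gcongr; exact hcm x
    _ = _ := by push_cast; ring

theorem lipschitzWith_mul_of_abs_le_one (hf : LipschitzWith C f) (hg : LipschitzWith D g)
    (hf1 : ∀ x, |f x| ≤ 1) (hg1 : ∀ x, |g x| ≤ 1) :
    LipschitzWith (C + D) fun x => f x * g x := by
  refine LipschitzWith.of_dist_le_mul fun x y => ?_
  have h1 := hf.dist_le_mul x y
  have h2 := hg.dist_le_mul x y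
  rw [Real.dist_eq] at h1 h2 ⊢
  have e : f x * g x - f y * g y = (f x - f y) * g x + f y * (g x - g y) := by ring
  rw [e]
  refine (abs_add_le _ _).trans ?_
  rw [abs_mul, abs_mul, NNReal.coe_add, add_mul]
  exact add_le_add ((mul_le_of_le_one_right (abs_nonneg _) (hg1 x)).trans h1)
    ((mul_le_of_le_one_left (abs_nonneg _) (hf1 y)).trans h2)

theorem lipschitzWith_sqrt_sq_add_sq (hf : LipschitzWith C f) (hg : LipschitzWith D g) :
    LipschitzWith (C + D) fun x => √(f x ^ 2 + g x ^ 2) := by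
  refine LipschitzWith.of_dist_le_mul fun x y => ?_
  have h1 := hf.dist_le_mul x y
  have h2 := hg.dist_le_mul x y
  rw [Real.dist_eq] at h1 h2 ⊢
  have e : ∀ z, √(f z ^ 2 + g z ^ 2) = ‖(⟨f z, g z⟩ : ℂ)‖ := fun z => by
    rw [Complex.norm_eq_sqrt_sq_add_sq]
  rw [e, e]
  refine (abs_norm_sub_norm_le _ _).trans ((Complex.norm_le_abs_re_add_abs_im _).trans ?_)
  rw [NNReal.coe_add, add_mul]
  exact add_le_add h1 h2

theorem lipschitzWith_const_mul (s : ℝ) (hf : LipschitzWith C f) :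
    LipschitzWith (‖s‖₊ * C) fun x => s * f x := by
  refine LipschitzWith.of_dist_le_mul fun x y => ?_
  have h1 := hf.dist_le_mul x y
  rw [Real.dist_eq] at h1 ⊢
  rw [← mul_sub, abs_mul, NNReal.coe_mul, coe_nnnorm, Real.norm_eq_abs, mul_assoc]
  gcongr

end Lipschitz

theorem lipschitzWith_coord (i : Fin 2) : LipschitzWith 1 fun x : Plane => x i := by
  refine LipschitzWith.of_dist_le_mul fun x y => ?_
  have := PiLp.norm_apply_le (p := 2) (x - y) i
  simpa [dist_eq_norm] using this

/-! ### The geometry of the stadium -/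

/-- The signed vertical distance of `x` to the strip `|x₂| ≤ δ`. -/
noncomputable def height (δ : ℝ) (x : Plane) : ℝ := x 1 - max (-δ) (min δ (x 1))

/-- The distance of `x` to the segment `{0} × [-δ, δ]`. -/
noncomputable def radius (δ : ℝ) (x : Plane) : ℝ := √(x 0 ^ 2 + height δ x ^ 2)

theorem radius_sq (δ : ℝ) (x : Plane) : radius δ x ^ 2 = x 0 ^ 2 + height δ x ^ 2 :=
  Real.sq_sqrt (by positivity)

theorem radius_nonneg (δ : ℝ) (x : Plane) : 0 ≤ radius δ x := Real.sqrt_nonneg _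

theorem abs_height_le_radius (δ : ℝ) (x : Plane) : |height δ x| ≤ radius δ x :=
  Real.abs_le_sqrt (by nlinarith [sq_nonneg (x 0)])

theorem abs_coord_le_radius (δ : ℝ) (x : Plane) : |x 0| ≤ radius δ x :=
  Real.abs_le_sqrt (by nlinarith [sq_nonneg (height δ x)])

theorem lipschitzWith_height (δ : ℝ) : LipschitzWith (1 + 1) (height δ) :=
  (lipschitzWith_coord 1).sub (((lipschitzWith_coord 1).const_min δ).const_max (-δ))

theorem lipschitzWith_radius (δ : ℝ) : LipschitzWith (1 + (1 + 1)) (radius δ) :=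
  lipschitzWith_sqrt_sq_add_sq (lipschitzWith_coord 0) (lipschitzWith_height δ)

theorem height_eq_zero {δ : ℝ} {x : Plane} (h : |x 1| ≤ δ) : height δ x = 0 := by
  obtain ⟨h1, h2⟩ := abs_le.1 h
  rw [height, min_eq_right h2, max_eq_right h1, sub_self]

theorem height_of_ge {δ : ℝ} (hδ : 0 < δ) {x : Plane} (h : δ ≤ x 1) : height δ x = x 1 - δ := by
  rw [height, min_eq_left h, max_eq_right (by linarith)]

theorem height_of_le {δ : ℝ} (hδ : 0 < δ) {x : Plane} (h : x 1 ≤ -δ) :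
    height δ x = x 1 + δ := by
  rw [height, min_eq_right (by linarith), max_eq_left h, sub_neg_eq_add]

/-- The stadium is the open unit neighbourhood of the segment $\{0\}\times[-\delta,\delta]$; its
openness and the location of its boundary follow at once. -/
theorem fullStadium_eq {δ : ℝ} (hδ : 1 < δ) : fullStadium δ = {x | radius δ x < 1} := by
  ext x
  have hr : radius δ x < 1 ↔ x 0 ^ 2 + height δ x ^ 2 < 1 := by
    rw [← radius_sq, sq_lt_one_iff₀ (radius_nonneg δ x)]
  simp only [Set.mem_ofPred_eq, hr, fullStadium, Set.mem_union, M₁, M₂, M₃]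
  have h0 := sq_nonneg (x 0)
  rcases le_total (x 1) (-δ) with h | h
  · rw [height_of_le (by linarith) h]
    constructor
    · rintro ((h1 | h1) | ⟨h1, h2⟩)
      · nlinarith
      · exact h1
      · have : x 1 = -δ := le_antisymm h (abs_le.1 h2).1
        rw [this]
        nlinarith [(sq_lt_one_iff_abs_lt_one (x 0)).2 h1]
    · exact fun h1 => Or.inl (Or.inr h1)
  rcases le_total δ (x 1) with h' | h'
  · rw [height_of_ge (by linarith) h']
    constructor
    · rintro ((h1 | h1) | ⟨h1, h2⟩)
      · exact h1
      · nlinarith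
      · have : x 1 = δ := le_antisymm (abs_le.1 h2).2 h'
        rw [this]
        nlinarith [(sq_lt_one_iff_abs_lt_one (x 0)).2 h1]
    · exact fun h1 => Or.inl (Or.inl h1)
  · rw [height_eq_zero (abs_le.2 ⟨h, h'⟩)]
    constructor
    · rintro ((h1 | h1) | ⟨h1, h2⟩)
      · nlinarith [sq_nonneg (x 1 - δ)]
      · nlinarith [sq_nonneg (x 1 + δ)]
      · nlinarith [(sq_lt_one_iff_abs_lt_one (x 0)).2 h1]
    · intro h1
      exact Or.inr ⟨(sq_lt_one_iff_abs_lt_one (x 0)).1 (by linarith), abs_le.2 ⟨h, h'⟩⟩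

theorem isOpen_fullStadium {δ : ℝ} (hδ : 1 < δ) : IsOpen (fullStadium δ) := by
  rw [fullStadium_eq hδ]
  exact isOpen_lt (lipschitzWith_radius δ).continuous continuous_const

theorem isOpen_stadium {δ : ℝ} (hδ : 1 < δ) : IsOpen (stadium δ) := by
  refine (isOpen_fullStadium hδ).sdiff (IsClosed.union ?_ ?_)
  · exact isClosed_le (by fun_prop) continuous_const
  · exact isClosed_le (by fun_prop) continuous_const

theorem radius_lt_one_of_mem_stadium {δ : ℝ} (hδ : 1 < δ) {x : Plane} (hx : x ∈ stadium δ) :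
    radius δ x < 1 := by
  have := hx.1
  rwa [fullStadium_eq hδ] at this

/-- Off the strip, `radius` is the distance to the centre of one of the holes. -/
theorem half_lt_radius_sq {δ : ℝ} (hδ : 1 < δ) {x : Plane} (hx : x ∈ stadium δ)
    (h : height δ x ≠ 0) : 1 / 2 < radius δ x ^ 2 := by
  have hx' := hx.2
  simp only [Set.mem_union, M₄, M₅, Set.mem_ofPred_eq, not_or, not_le] at hx'
  rw [radius_sq]
  rcases le_total (x 1) (-δ) with h1 | h1
  · rw [height_of_le (by linarith) h1]
    exact hx'.2
  rcases le_total δ (x 1) with h2 | h2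
  · rw [height_of_ge (by linarith) h2]
    exact hx'.1
  · exact absurd (height_eq_zero (abs_le.2 ⟨h1, h2⟩)) h

theorem radius_eq_one_of_mem_outerBoundary {δ : ℝ} (hδ : 1 < δ) {x : Plane}
    (hx : x ∈ outerBoundary δ) : radius δ x = 1 := by
  rw [outerBoundary, fullStadium_eq hδ] at hx
  exact frontier_lt_subset_eq (lipschitzWith_radius δ).continuous continuous_const hx

theorem volume_stadium_ne_top {δ : ℝ} (hδ : 1 < δ) : volume (stadium δ) ≠ ⊤ := by
  have hsub : stadium δ ⊆ Metric.closedBall 0 (δ + 2) := by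
    intro x hx
    have hr := radius_lt_one_of_mem_stadium hδ hx
    have h0 := abs_coord_le_radius δ x
    have h1 := abs_height_le_radius δ x
    have h2 : |x 1| ≤ δ + 1 := by
      have hle : |x 1 - height δ x| ≤ δ := by
        rw [height, sub_sub_cancel, abs_le]
        exact ⟨le_max_left _ _, max_le (by linarith) (min_le_left _ _)⟩
      have := abs_add_le (x 1 - height δ x) (height δ x)
      rw [sub_add_cancel] at this
      linarith
    rw [mem_closedBall_zero_iff, EuclideanSpace.norm_eq, Fin.sum_univ_two, Real.norm_eq_abs,
      Real.norm_eq_abs]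
    refine Real.sqrt_le_iff.2 ⟨by linarith, ?_⟩
    nlinarith [abs_nonneg (x 0), abs_nonneg (x 1)]
  exact ((measure_mono hsub).trans_lt measure_closedBall_lt_top).ne

theorem stadium_inter_le_abs_subset {δ : ℝ} (hδ : 1 < δ) :
    stadium δ ∩ {x | δ ≤ |x 1|} ⊆
      Metric.closedBall !₂[0, δ] 1 ∪ Metric.closedBall !₂[0, -δ] 1 := by
  rintro x ⟨hx, h⟩
  have hr := radius_lt_one_of_mem_stadium hδ hx
  have hr2 : radius δ x ^ 2 < 1 := (sq_lt_one_iff₀ (radius_nonneg δ x)).2 hr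
  rw [radius_sq] at hr2
  rcases le_abs.1 (Set.mem_ofPred_eq ▸ h) with h | h
  · left
    rw [height_of_ge (by linarith) h] at hr2
    rw [Metric.mem_closedBall, EuclideanSpace.dist_eq, Fin.sum_univ_two]
    refine Real.sqrt_le_iff.2 ⟨zero_le_one, ?_⟩
    simp [Real.dist_eq, sq_abs]
    exact hr2.le
  · right
    rw [height_of_le (by linarith) (by linarith)] at hr2
    rw [Metric.mem_closedBall, EuclideanSpace.dist_eq, Fin.sum_univ_two]
    refine Real.sqrt_le_iff.2 ⟨zero_le_one, ?_⟩
    simp [Real.dist_eq, sq_abs]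
    exact hr2.le

/-- The bound is independent of $\delta$: the caps lie in two unit discs. -/
theorem measureReal_stadium_inter_le_abs {δ : ℝ} (hδ : 1 < δ) :
    volume.real (stadium δ ∩ {x | δ ≤ |x 1|}) ≤
      2 * volume.real (Metric.closedBall (0 : Plane) 1) := by
  refine (measureReal_mono (stadium_inter_le_abs_subset hδ)
    (measure_union_lt_top measure_closedBall_lt_top measure_closedBall_lt_top).ne).trans ?_
  refine (measureReal_union_le _ _).trans (le_of_eq ?_)
  simp only [measureReal_def]
  rw [Measure.addHaar_closedBall_center, Measure.addHaar_closedBall_center volume !₂[0, -δ]]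
  ring

theorem abs_div_max_le_one {a r c : ℝ} (hc : 0 < c) (h : |a| ≤ r) : |a / max r c| ≤ 1 := by
  have hm : 0 < max r c := lt_max_of_lt_right hc
  rw [abs_div, abs_of_pos hm]
  exact div_le_one_of_le₀ (h.trans (le_max_left _ _)) hm.le

theorem norm_eq_one_of_sq {a b : ℝ} (h : a ^ 2 + b ^ 2 = 1) : ‖(!₂[a, b] : Plane)‖ = 1 := by
  rw [EuclideanSpace.norm_eq, Fin.sum_univ_two]
  simp [h]

/-! ### A line field of bounded energy -/

/-- The first component of the tangent, cut off near the segment `{0} × [-δ, δ]`. -/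
noncomputable def cutTangentFst (δ : ℝ) (x : Plane) : ℝ := height δ x / max (radius δ x) (1 / 2)

/-- The second component of the tangent, cut off near the segment `{0} × [-δ, δ]`. -/
noncomputable def cutTangentSnd (δ : ℝ) (x : Plane) : ℝ := -x 0 / max (radius δ x) (1 / 2)

theorem abs_cutTangentFst_le (δ : ℝ) (x : Plane) : |cutTangentFst δ x| ≤ 1 :=
  abs_div_max_le_one one_half_pos (abs_height_le_radius δ x)

theorem abs_cutTangentSnd_le (δ : ℝ) (x : Plane) : |cutTangentSnd δ x| ≤ 1 :=
  abs_div_max_le_one one_half_pos (by rw [abs_neg]; exact abs_coord_le_radius δ x)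

/-- One constant serves all $\delta$, because `height`, `radius` and the cutoff level $1/2$ have
$\delta$-independent bounds. -/
theorem exists_lipschitzWith_cutTangent : ∃ K : NNReal, ∀ δ,
    LipschitzWith K (cutTangentFst δ) ∧ LipschitzWith K (cutTangentSnd δ) := by
  have hm : ∀ δ, LipschitzWith (1 + (1 + 1)) fun x => max (radius δ x) (1 / 2) :=
    fun δ => (lipschitzWith_radius δ).max_const _
  have hc : (0 : NNReal) < 1 / 2 := by positivity
  have hcm : ∀ δ x, ((1 / 2 : NNReal) : ℝ) ≤ max (radius δ x) (1 / 2) := fun δ x => by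
    push_cast
    exact le_max_right _ _
  refine ⟨((1 + 1) + (1 + (1 + 1))) / (1 / 2), fun δ => ⟨?_, ?_⟩⟩
  · exact lipschitzWith_div (lipschitzWith_height δ) (hm δ) hc (hcm δ)
      fun x => (abs_height_le_radius δ x).trans (le_max_left _ _)
  · refine (lipschitzWith_div (lipschitzWith_coord 0).neg (hm δ) hc (hcm δ)
      fun x => ?_).weaken (by gcongr; simp)
    rw [Pi.neg_apply, abs_neg]
    exact (abs_coord_le_radius δ x).trans (le_max_left _ _)

/-- The line field which is tangential around the two ends of the segment `{0} × [-δ, δ]`, and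
vertical in the strip `|x₂| ≤ δ`. -/
noncomputable def tangentLineField (s δ : ℝ) (x : Plane) : Matrix (Fin 3) (Fin 3) ℝ :=
  s • (!![cutTangentFst δ x * cutTangentFst δ x, cutTangentFst δ x * cutTangentSnd δ x, 0;
    cutTangentFst δ x * cutTangentSnd δ x, 1 - cutTangentFst δ x * cutTangentFst δ x, 0;
    0, 0, 0] - (1 / 3 : ℝ) • 1)

theorem lineTensor_apply_eq (s : ℝ) (n : Plane) : lineTensor s n =
    s • (!![n 0 * n 0, n 0 * n 1, 0; n 0 * n 1, n 1 * n 1, 0; 0, 0, 0] - (1 / 3 : ℝ) • 1) := by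
  ext a b
  fin_cases a <;> fin_cases b <;>
    simp [lineTensor, mul_comm]

/-- Only the product of the two components is constrained, not `cutTangentSnd` alone. In the strip,
where the first component vanishes, this allows $n=(0,1)$ although `cutTangentSnd` changes sign
there. -/
theorem tangentLineField_eq_lineTensor {s δ : ℝ} {x n : Plane} (hn : ‖n‖ = 1)
    (h0 : n 0 = cutTangentFst δ x)
    (h1 : cutTangentFst δ x * cutTangentSnd δ x = n 0 * n 1) :
    tangentLineField s δ x = lineTensor s n := by
  have h2 : n 1 * n 1 = 1 - n 0 * n 0 := by
    rw [EuclideanSpace.norm_eq, Fin.sum_univ_two, Real.sqrt_eq_one] at hn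
    simp only [Real.norm_eq_abs, sq_abs] at hn
    linarith
  rw [lineTensor_apply_eq, tangentLineField, h1, h2, h0]

theorem exists_lipschitzWith_tangentLineField (s : ℝ) : ∃ K : NNReal, ∀ δ a b,
    LipschitzWith K fun x => tangentLineField s δ x a b := by
  obtain ⟨K, hK⟩ := exists_lipschitzWith_cutTangent
  refine ⟨‖s‖₊ * (K + K), fun δ a b => ?_⟩
  have hA := lipschitzWith_mul_of_abs_le_one (hK δ).1 (hK δ).1 (abs_cutTangentFst_le δ)
    (abs_cutTangentFst_le δ)
  have hB := lipschitzWith_mul_of_abs_le_one (hK δ).1 (hK δ).2 (abs_cutTangentFst_le δ)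
    (abs_cutTangentSnd_le δ)
  have hconst : ∀ c : ℝ, LipschitzWith (K + K) fun _ : Plane => c := fun c =>
    (LipschitzWith.const c).weaken zero_le
  have hsub : ∀ {f : Plane → ℝ} (c : ℝ), LipschitzWith (K + K) f →
      LipschitzWith (K + K) fun x => f x - c := fun c hf => by
    simpa using hf.sub (LipschitzWith.const c)
  have hsub' : LipschitzWith (K + K) fun x => 1 - cutTangentFst δ x * cutTangentFst δ x := by
    simpa using (LipschitzWith.const (1 : ℝ)).sub hA
  apply lipschitzWith_const_mul s
  fin_cases a <;> fin_cases b
  · exact hsub _ hA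
  · exact hsub _ hB
  · exact hsub _ (hconst 0)
  · exact hsub _ hB
  · exact hsub _ hsub'
  · exact hsub _ (hconst 0)
  · exact hsub _ (hconst 0)
  · exact hsub _ (hconst 0)
  · exact hsub _ (hconst 0)

theorem exists_abs_tangentLineField_le (s : ℝ) : ∃ B : ℝ, ∀ δ x a b,
    |tangentLineField s δ x a b| ≤ B := by
  refine ⟨|s| * 2, fun δ x a b => ?_⟩
  have h0 : |cutTangentFst δ x * cutTangentFst δ x| ≤ 1 := by
    rw [abs_mul]
    exact mul_le_one₀ (abs_cutTangentFst_le δ x) (abs_nonneg _) (abs_cutTangentFst_le δ x)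
  have h1 : |cutTangentFst δ x * cutTangentSnd δ x| ≤ 1 := by
    rw [abs_mul]
    exact mul_le_one₀ (abs_cutTangentFst_le δ x) (abs_nonneg _) (abs_cutTangentSnd_le δ x)
  have h2 := mul_self_nonneg (cutTangentFst δ x)
  rw [tangentLineField, Matrix.smul_apply, smul_eq_mul, abs_mul]
  refine mul_le_mul_of_nonneg_left ?_ (abs_nonneg _)
  rw [abs_le] at *
  fin_cases a <;> fin_cases b <;> simp <;> constructor <;> linarith

/-- The entries depend on `cutTangentSnd` only through its product with `cutTangentFst`, which
vanishes in the strip. This is where forgetting the orientation saves energy. -/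
theorem lineDeriv_tangentLineField_eq_zero {s δ : ℝ} {x : Plane} (hx : |x 1| < δ) (a b : Fin 3)
    (v : Plane) : lineDeriv ℝ (fun y => tangentLineField s δ y a b) x v = 0 := by
  have hev : (fun y => tangentLineField s δ y a b) =ᶠ[𝓝 x]
      fun _ => tangentLineField s δ x a b := by
    have hopen : IsOpen {y : Plane | |y 1| < δ} := isOpen_lt (by fun_prop) continuous_const
    filter_upwards [hopen.mem_nhds (show x ∈ {y : Plane | |y 1| < δ} from hx)] with y hy
    have hy0 : cutTangentFst δ y = 0 := by
      rw [cutTangentFst, height_eq_zero (le_of_lt hy), zero_div]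
    have hx0 : cutTangentFst δ x = 0 := by
      rw [cutTangentFst, height_eq_zero hx.le, zero_div]
    simp only [tangentLineField, hy0, hx0, zero_mul]
  rw [hev.lineDeriv_eq]
  simp [lineDeriv]

theorem tangentLineField_mem {δ : ℝ} (hδ : 1 < δ) (s : ℝ) :
    tangentLineField s δ ∈ tangentLineFields s δ := by
  obtain ⟨K, hK⟩ := exists_lipschitzWith_tangentLineField s
  obtain ⟨B, hB⟩ := exists_abs_tangentLineField_le s
  have hW : ∀ a b, MemW12 (stadium δ) fun x => tangentLineField s δ x a b := fun a b =>
    memW12_of_lipschitzWith (volume_stadium_ne_top hδ) (hK δ a b) fun x => hB δ x a b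
  refine ⟨hW, ?_, fun a b => ?_⟩
  · rw [ae_restrict_iff' (isOpen_stadium hδ).measurableSet]
    refine .of_forall fun x hx => ?_
    by_cases h : height δ x = 0
    · have h0 : cutTangentFst δ x = 0 := by rw [cutTangentFst, h, zero_div]
      have hn : ‖(!₂[0, 1] : Plane)‖ = 1 := norm_eq_one_of_sq (by norm_num)
      exact ⟨!₂[0, 1], hn, tangentLineField_eq_lineTensor hn (by simp [h0]) (by simp [h0])⟩
    · have hr := half_lt_radius_sq hδ hx h
      -- The cutoff at $1/2$ is inactive, since the holes have radius $\sqrt{1/2}>1/2$.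
      have hr' : 1 / 2 ≤ radius δ x := by nlinarith [radius_nonneg δ x]
      have hr0 : radius δ x ≠ 0 := by linarith
      have hn : ‖(!₂[cutTangentFst δ x, cutTangentSnd δ x] : Plane)‖ = 1 := by
        apply norm_eq_one_of_sq
        rw [cutTangentFst, cutTangentSnd, max_eq_left hr']
        field_simp
        rw [radius_sq]
        ring
      exact ⟨_, hn, tangentLineField_eq_lineTensor hn (by simp) (by simp)⟩
  · refine hasTrace_of_continuous (isOpen_stadium hδ) isClosed_frontier.measurableSet (hW a b)
      (hK δ a b).continuous fun x hx => ?_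
    have hr := radius_eq_one_of_mem_outerBoundary hδ hx
    have h0 : cutTangentFst δ x = height δ x := by
      rw [cutTangentFst, hr, max_eq_left (by norm_num), div_one]
    have h1 : cutTangentSnd δ x = -x 0 := by
      rw [cutTangentSnd, hr, max_eq_left (by norm_num), div_one]
    have hn : ‖clockwiseTangent δ x‖ = 1 := by
      refine norm_eq_one_of_sq ?_
      have := radius_sq δ x
      rw [hr, height] at this
      linarith
    rw [tangentLineField_eq_lineTensor hn]
    · rw [h0]
      rfl
    · rw [h0, h1]
      rfl

theorem exists_lineEnergy_tangentLineField_le (s : ℝ) : ∃ K : ℝ, ∀ δ, 1 < δ →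
    lineEnergy δ (tangentLineField s δ) ≤ K := by
  obtain ⟨K, hK⟩ := exists_lipschitzWith_tangentLineField s
  -- Nine entries with two partial derivatives each, every one bounded by `K`, on the two caps.
  refine ⟨18 * K ^ 2 * (2 * volume.real (Metric.closedBall (0 : Plane) 1)), fun δ hδ => ?_⟩
  have hS : MeasurableSet {x : Plane | δ ≤ |x 1|} :=
    (isClosed_le continuous_const (by fun_prop)).measurableSet
  have hfin : IsFiniteMeasure (volume.restrict (stadium δ)) :=
    ⟨by simpa using (volume_stadium_ne_top hδ).lt_top⟩
  have hw : ∀ᵐ x ∂volume.restrict (stadium δ), ∀ (p : Fin 3 × Fin 3) (i : Fin 2),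
      weakPartial (stadium δ) i (fun y => tangentLineField s δ y p.1 p.2) x =
        lineDeriv ℝ (fun y => tangentLineField s δ y p.1 p.2) x
          (EuclideanSpace.single i 1) := by
    rw [ae_all_iff]
    intro p
    rw [ae_all_iff]
    intro i
    exact (isWeakPartial_lineDeriv (hK δ p.1 p.2) i).weakPartial_ae_eq (isOpen_stadium hδ)
  have hbound : ∀ᵐ x ∂volume.restrict (stadium δ), ∑ p : Fin 3 × Fin 3, ∑ i : Fin 2,
      weakPartial (stadium δ) i (fun y => tangentLineField s δ y p.1 p.2) x ^ 2 ≤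
        {x : Plane | δ ≤ |x 1|}.indicator (fun _ => 18 * (K : ℝ) ^ 2) x := by
    filter_upwards [hw] with x hx
    by_cases h : δ ≤ |x 1|
    · rw [Set.indicator_of_mem (show x ∈ {x : Plane | δ ≤ |x 1|} from h)]
      have : ∀ (p : Fin 3 × Fin 3) (i : Fin 2), weakPartial (stadium δ) i
          (fun y => tangentLineField s δ y p.1 p.2) x ^ 2 ≤ (K : ℝ) ^ 2 := fun p i => by
        rw [hx, sq_le_sq, NNReal.abs_eq]
        exact abs_lineDeriv_single_le (hK δ p.1 p.2) i x
      refine (Finset.sum_le_sum fun p _ => Finset.sum_le_sum fun i _ => this p i).trans ?_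
      simp
      linarith
    · rw [Set.indicator_of_notMem (show x ∉ {x : Plane | δ ≤ |x 1|} from h)]
      refine le_of_eq (Finset.sum_eq_zero fun p _ => Finset.sum_eq_zero fun i _ => ?_)
      rw [hx, lineDeriv_tangentLineField_eq_zero (not_le.1 h)]
      norm_num
  calc lineEnergy δ (tangentLineField s δ)
      ≤ ∫ x in stadium δ, {x : Plane | δ ≤ |x 1|}.indicator (fun _ => 18 * (K : ℝ) ^ 2) x := by
        refine integral_mono_of_nonneg (.of_forall fun x => ?_)
          ((integrable_const _).indicator hS) hbound
        exact Finset.sum_nonneg fun p _ => Finset.sum_nonneg fun i _ => sq_nonneg _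
    _ = 18 * (K : ℝ) ^ 2 * volume.real (stadium δ ∩ {x | δ ≤ |x 1|}) := by
        rw [setIntegral_indicator hS, setIntegral_const, smul_eq_mul, mul_comm]
    _ ≤ _ := by
        gcongr
        exact measureReal_stadium_inter_le_abs hδ

/-! ### An admissible vector field -/

/-- The first component of a field which is the tangent on the outer boundary, and vanishes
only in the lower hole. -/
noncomputable def extTangentFst (δ : ℝ) (x : Plane) : ℝ := height δ x + (1 - radius δ x)

/-- The norm of `(extTangentFst δ x, -x₁)`. -/
noncomputable def extTangentNorm (δ : ℝ) (x : Plane) : ℝ := √(extTangentFst δ x ^ 2 + x 0 ^ 2)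

/-- A unit vector field outside of the lower hole which is `σ` times the tangent on the outer
boundary. -/
noncomputable def tangentVectorField (δ σ : ℝ) (x : Plane) : Plane :=
  !₂[σ * (extTangentFst δ x / max (extTangentNorm δ x) (1 / 4)),
    σ * (-x 0 / max (extTangentNorm δ x) (1 / 4))]

/-- If $x_1$ is small, then `radius` is close to $|h|$, with $h$ the height, so the first component
is close to 1 for $h\ge0$ and to $1-2|h|$ for $h<0$. The latter vanishes only near $|h|=1/2$, inside
the lower hole, which carries all the winding of the tangent. -/
theorem quarter_le_extTangentNorm {δ : ℝ} (hδ : 1 < δ) {x : Plane} (hx : x ∈ stadium δ) :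
    1 / 4 ≤ extTangentNorm δ x := by
  refine Real.le_sqrt_of_sq_le ?_
  by_contra! hlt
  have hr1 := radius_lt_one_of_mem_stadium hδ hx
  have hr2 := radius_sq δ x
  have hr0 := radius_nonneg δ x
  have hx0 : |x 0| < 1 / 4 := by
    rw [← sq_lt_sq₀ (abs_nonneg _) (by norm_num), sq_abs]
    nlinarith [sq_nonneg (extTangentFst δ x)]
  have hw : |extTangentFst δ x| < 1 / 4 := by
    rw [← sq_lt_sq₀ (abs_nonneg _) (by norm_num), sq_abs]
    nlinarith [sq_nonneg (x 0)]
  rw [extTangentFst, abs_lt] at hw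
  rw [abs_lt] at hx0
  rcases le_or_gt 0 (height δ x) with h | h
  · nlinarith
  · have hh := half_lt_radius_sq hδ hx h.ne
    -- A rational lower bound for $\sqrt{1/2}$.
    have h1 : radius δ x > 0.7 := by nlinarith
    nlinarith

/-- Non-emptiness of the vector class is also essential for comparing the infima, since `sInf ∅ = 0`
in `ℝ`. -/
theorem tangentVectorField_mem {δ : ℝ} (hδ : 1 < δ) {σ : ℝ} (hσ : σ = 1 ∨ σ = -1) :
    tangentVectorField δ σ ∈ tangentVectorFields δ σ := by
  have hσ1 : |σ| = 1 := by rcases hσ with rfl | rfl <;> simp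
  have hσ2 : σ ^ 2 = 1 := by rcases hσ with rfl | rfl <;> simp
  have hF : LipschitzWith _ (extTangentFst δ) :=
    (lipschitzWith_height δ).add ((LipschitzWith.const (1 : ℝ)).sub (lipschitzWith_radius δ))
  have hm : LipschitzWith _ fun x => max (extTangentNorm δ x) (1 / 4) :=
    (lipschitzWith_sqrt_sq_add_sq hF (lipschitzWith_coord 0)).max_const (1 / 4)
  have hc : (0 : NNReal) < 1 / 4 := by positivity
  have hcm : ∀ x, ((1 / 4 : NNReal) : ℝ) ≤ max (extTangentNorm δ x) (1 / 4) := fun x => by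
    push_cast
    exact le_max_right _ _
  have hFle : ∀ x, |extTangentFst δ x| ≤ extTangentNorm δ x := fun x =>
    Real.abs_le_sqrt (by nlinarith [sq_nonneg (x 0)])
  have hxle : ∀ x : Plane, |-x 0| ≤ extTangentNorm δ x := fun x => by
    rw [abs_neg]
    exact Real.abs_le_sqrt (by nlinarith [sq_nonneg (extTangentFst δ x)])
  have hL : ∀ a, ∃ C, LipschitzWith C fun x => tangentVectorField δ σ x a := fun a => by
    fin_cases a
    · exact ⟨_, lipschitzWith_const_mul σ (lipschitzWith_div hF hm hc hcm
        fun x => (hFle x).trans (le_max_left _ _))⟩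
    · exact ⟨_, lipschitzWith_const_mul σ (lipschitzWith_div (lipschitzWith_coord 0).neg hm hc hcm
        fun x => (hxle x).trans (le_max_left _ _))⟩
  have hB : ∀ a x, |tangentVectorField δ σ x a| ≤ 1 := fun a x => by
    fin_cases a
    · change |σ * _| ≤ 1
      rw [abs_mul, hσ1, one_mul]
      exact abs_div_max_le_one (by norm_num) (hFle x)
    · change |σ * _| ≤ 1
      rw [abs_mul, hσ1, one_mul]
      exact abs_div_max_le_one (by norm_num) (hxle x)
  have hW : ∀ a, MemW12 (stadium δ) fun x => tangentVectorField δ σ x a := fun a => by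
    obtain ⟨C, hC⟩ := hL a
    exact memW12_of_lipschitzWith (volume_stadium_ne_top hδ) hC (hB a)
  refine ⟨hW, ?_, fun a => ?_⟩
  · rw [ae_restrict_iff' (isOpen_stadium hδ).measurableSet]
    refine .of_forall fun x hx => norm_eq_one_of_sq ?_
    have hq := quarter_le_extTangentNorm hδ hx
    have hq0 : extTangentNorm δ x ≠ 0 := by linarith
    have hsq : extTangentNorm δ x ^ 2 = extTangentFst δ x ^ 2 + x 0 ^ 2 :=
      Real.sq_sqrt (by positivity)
    rw [max_eq_left hq, mul_pow, mul_pow, hσ2]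
    field_simp
    rw [hsq]
  · obtain ⟨C, hC⟩ := hL a
    refine hasTrace_of_continuous (isOpen_stadium hδ) isClosed_frontier.measurableSet (hW a)
      hC.continuous fun x hx => ?_
    have hr := radius_eq_one_of_mem_outerBoundary hδ hx
    have hF1 : extTangentFst δ x = height δ x := by rw [extTangentFst, hr]; ring
    have hm1 : max (extTangentNorm δ x) (1 / 4) = 1 := by
      have : extTangentNorm δ x = 1 := by
        rw [extTangentNorm, hF1, add_comm]
        exact hr
      rw [this]
      norm_num
    fin_cases a
    · change σ * (extTangentFst δ x / max (extTangentNorm δ x) (1 / 4)) = _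
      rw [hm1, hF1, div_one]
      rfl
    · change σ * (-x 0 / max (extTangentNorm δ x) (1 / 4)) = _
      rw [hm1, div_one]
      rfl

/-! ### The fundamental theorem of calculus for weak derivatives on an interval -/

/-- The derivative of `Real.smoothTransition` serves as a smooth kernel of mass one supported in
$[0,1]$. -/
theorem deriv_smoothTransition_eq_zero {t : ℝ} (ht : t ∉ Set.Icc (0 : ℝ) 1) :
    deriv Real.smoothTransition t = 0 := by
  have hev : ∃ c : ℝ, Real.smoothTransition =ᶠ[𝓝 t] fun _ => c := by
    rw [Set.mem_Icc, not_and_or, not_le, not_le] at ht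
    rcases ht with ht | ht
    · refine ⟨0, ?_⟩
      filter_upwards [Iio_mem_nhds ht] with y hy
      exact Real.smoothTransition.zero_of_nonpos (le_of_lt hy)
    · refine ⟨1, ?_⟩
      filter_upwards [Ioi_mem_nhds ht] with y hy
      exact Real.smoothTransition.one_of_one_le (le_of_lt hy)
  obtain ⟨c, hc⟩ := hev
  rw [hc.deriv_eq, deriv_const]

theorem continuous_deriv_smoothTransition : Continuous (deriv Real.smoothTransition) :=
  (Real.smoothTransition.contDiff (n := 1)).continuous_deriv le_rfl

theorem integrable_deriv_smoothTransition : Integrable (deriv Real.smoothTransition) :=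
  continuous_deriv_smoothTransition.integrable_of_hasCompactSupport
    (HasCompactSupport.intro isCompact_Icc fun _ hx => deriv_smoothTransition_eq_zero hx)

theorem integral_deriv_smoothTransition : ∫ t, deriv Real.smoothTransition t = 1 := by
  rw [← intervalIntegral.integral_eq_integral_of_support_subset (a := -1) (b := 2)]
  · rw [intervalIntegral.integral_deriv_eq_sub
      (fun x _ => (Real.smoothTransition.contDiff (n := 1)).differentiable one_ne_zero x)
      (continuous_deriv_smoothTransition.intervalIntegrable _ _),
      Real.smoothTransition.one_of_one_le (by norm_num),
      Real.smoothTransition.zero_of_nonpos (by norm_num), sub_zero]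
  · intro t ht
    by_contra hn
    refine ht (deriv_smoothTransition_eq_zero fun h => hn ⟨?_, ?_⟩)
    · linarith [h.1]
    · linarith [h.2]

/-- The rescaled kernel lives on $[-1+\frac1{n+2},-1+\frac2{n+2}]$ and has mass one. Substitution
moves $n$ from the kernel into the argument of `h`, where dominated convergence applies. -/
theorem tendsto_integral_mul_deriv_smoothTransition {h : ℝ → ℝ} (hc : Continuous h) :
    Tendsto (fun n : ℕ => ∫ t in (-1 : ℝ)..1,
      h t * ((n + 2) * deriv Real.smoothTransition ((n + 2) * t + (n + 1)))) atTop
      (𝓝 (h (-1))) := by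
  -- For $u\in[0,1]$ the substituted argument $(u-(n+1))/(n+2)$ stays in $[-1,0]$.
  obtain ⟨B, hB⟩ := isCompact_Icc.exists_bound_of_continuousOn
    (s := Set.Icc (-1 : ℝ) 0) hc.continuousOn
  have e : ∀ n : ℕ, ∫ t in (-1 : ℝ)..1,
      h t * ((n + 2) * deriv Real.smoothTransition ((n + 2) * t + (n + 1))) =
      ∫ t, h ((t - (n + 1)) / (n + 2)) * deriv Real.smoothTransition t := by
    intro n
    have hn : (0 : ℝ) < n + 2 := by positivity
    rw [← intervalIntegral.integral_eq_integral_of_support_subset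
      (a := (n + 2) * (-1) + (n + 1)) (b := (n + 2) * 1 + (n + 1))]
    · have := intervalIntegral.mul_integral_comp_mul_add (a := -1) (b := 1)
        (f := fun t => h ((t - (n + 1)) / (n + 2)) * deriv Real.smoothTransition t)
        ((n : ℝ) + 2) ((n : ℝ) + 1)
      rw [← this, ← intervalIntegral.integral_const_mul]
      congr 1
      ext t
      have e1 : ((n + 2) * t + (n + 1) - (n + 1)) / ((n : ℝ) + 2) = t := by
        field_simp
        ring
      rw [e1]
      ring
    · intro t ht
      by_contra hnt
      have hn0 : (0 : ℝ) ≤ n := n.cast_nonneg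
      have h0 : deriv Real.smoothTransition t = 0 := deriv_smoothTransition_eq_zero fun h01 =>
        hnt ⟨by linarith [h01.1], by linarith [h01.2]⟩
      exact ht (by simp [h0])
  simp only [e]
  have hlim : ∫ t, h (-1) * deriv Real.smoothTransition t = h (-1) := by
    rw [integral_const_mul, integral_deriv_smoothTransition, mul_one]
  rw [← hlim]
  refine tendsto_integral_of_dominated_convergence
    (fun t => B * |deriv Real.smoothTransition t|) (fun n => ?_)
    (integrable_deriv_smoothTransition.abs.const_mul B) (fun n => .of_forall fun t => ?_)
    (.of_forall fun t => ?_)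
  · exact ((hc.comp (by fun_prop)).mul continuous_deriv_smoothTransition).aestronglyMeasurable
  · rw [norm_mul, Real.norm_eq_abs (deriv _ _)]
    by_cases ht : t ∈ Set.Icc (0 : ℝ) 1
    · gcongr
      refine hB _ ⟨?_, ?_⟩
      · rw [le_div_iff₀ (by positivity)]
        linarith [ht.1]
      · rw [div_le_iff₀ (by positivity)]
        have : (0 : ℝ) ≤ n := n.cast_nonneg
        linarith [ht.2]
    · simp [deriv_smoothTransition_eq_zero ht]
  · refine Tendsto.mul_const _ ((hc.tendsto _).comp ?_)
    have h1 : Tendsto (fun n : ℕ => -1 + (t + 1) / ((n : ℝ) + 2)) atTop (𝓝 (-1 + 0)) :=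
      tendsto_const_nhds.add (tendsto_const_nhds.div_atTop
        (tendsto_natCast_atTop_atTop.atTop_add tendsto_const_nhds))
    rw [add_zero] at h1
    refine h1.congr fun n => ?_
    have : (n : ℝ) + 2 ≠ 0 := by positivity
    field_simp
    ring

/-- A smooth cutoff function which exhausts the interval `(-1, 1)` as `n → ∞`. -/
noncomputable def intervalCutoff (n : ℕ) (t : ℝ) : ℝ :=
  Real.smoothTransition ((n + 2) * t + (n + 1)) +
    Real.smoothTransition ((n + 2) * (-t) + (n + 1)) - 1

theorem contDiff_intervalCutoff (n : ℕ) : ContDiff ℝ ∞ (intervalCutoff n) := by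
  unfold intervalCutoff
  exact ((Real.smoothTransition.contDiff.comp (by fun_prop)).add
    (Real.smoothTransition.contDiff.comp (by fun_prop))).sub contDiff_const

theorem deriv_intervalCutoff (n : ℕ) (t : ℝ) : deriv (intervalCutoff n) t =
    (n + 2) * deriv Real.smoothTransition ((n + 2) * t + (n + 1)) -
      (n + 2) * deriv Real.smoothTransition ((n + 2) * (-t) + (n + 1)) := by
  have hd : ∀ x, HasDerivAt Real.smoothTransition (deriv Real.smoothTransition x) x := fun x =>
    ((Real.smoothTransition.contDiff (n := 1)).differentiable one_ne_zero x).hasDerivAt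
  have h1 : HasDerivAt (fun t : ℝ => ((n : ℝ) + 2) * t + (n + 1)) (n + 2) t := by
    simpa using ((hasDerivAt_id t).const_mul ((n : ℝ) + 2)).add_const ((n : ℝ) + 1)
  have h2 : HasDerivAt (fun t : ℝ => ((n : ℝ) + 2) * (-t) + (n + 1)) (-(n + 2)) t := by
    simpa using ((hasDerivAt_id t).neg.const_mul ((n : ℝ) + 2)).add_const ((n : ℝ) + 1)
  have h := (((hd _).comp t h1).add ((hd _).comp t h2)).sub_const 1
  refine (HasDerivAt.deriv (f := intervalCutoff n) h).trans ?_
  ring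

/-- The shift $n+1$, one less than the factor $n+2$, makes the argument of the relevant transition
$-1$ at an endpoint, so the support stays strictly inside $(-1,1)$. -/
theorem intervalCutoff_eq_zero (n : ℕ) {t : ℝ}
    (ht : t ∉ Set.Icc (-1 + 1 / ((n : ℝ) + 2)) (1 - 1 / ((n : ℝ) + 2))) :
    intervalCutoff n t = 0 := by
  have hn : (0 : ℝ) ≤ n := n.cast_nonneg
  have hk : (0 : ℝ) < n + 2 := by positivity
  have e : ((n : ℝ) + 2) * (1 / ((n : ℝ) + 2)) = 1 := by field_simp
  rw [Set.mem_Icc, not_and_or, not_le, not_le] at ht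
  rw [intervalCutoff]
  rcases ht with ht | ht
  · have := mul_lt_mul_of_pos_left ht hk
    rw [Real.smoothTransition.zero_of_nonpos (by nlinarith),
      Real.smoothTransition.one_of_one_le (by nlinarith)]
    ring
  · have := mul_lt_mul_of_pos_left ht hk
    rw [Real.smoothTransition.one_of_one_le (by nlinarith),
      Real.smoothTransition.zero_of_nonpos (by nlinarith)]
    ring

theorem tsupport_intervalCutoff_subset (n : ℕ) : tsupport (intervalCutoff n) ⊆
    Set.Icc (-1 + 1 / ((n : ℝ) + 2)) (1 - 1 / ((n : ℝ) + 2)) :=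
  closure_minimal (fun _ ht => by_contra fun h => ht (intervalCutoff_eq_zero n h)) isClosed_Icc

theorem abs_intervalCutoff_le (n : ℕ) (t : ℝ) : |intervalCutoff n t| ≤ 1 := by
  rw [intervalCutoff, abs_le]
  constructor <;>
    linarith [Real.smoothTransition.nonneg ((n + 2) * t + (n + 1)),
      Real.smoothTransition.nonneg ((n + 2) * (-t) + (n + 1)),
      Real.smoothTransition.le_one ((n + 2) * t + (n + 1)),
      Real.smoothTransition.le_one ((n + 2) * (-t) + (n + 1))]

theorem tendsto_intervalCutoff {t : ℝ} (ht : t ∈ Set.Ioo (-1 : ℝ) 1) :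
    Tendsto (fun n => intervalCutoff n t) atTop (𝓝 1) := by
  have key : ∀ r : ℝ, -1 < r → ∀ᶠ n : ℕ in atTop, 1 ≤ ((n : ℝ) + 2) * r + (n + 1) := by
    intro r hr
    have : Tendsto (fun n : ℕ => (n : ℝ) * (r + 1)) atTop atTop :=
      tendsto_natCast_atTop_atTop.atTop_mul_const (by linarith)
    filter_upwards [this.eventually_ge_atTop (-2 * r)] with n hn
    linarith
  refine tendsto_const_nhds.congr' ?_
  filter_upwards [key t ht.1, key (-t) (by linarith [ht.2])] with n h1 h2
  rw [intervalCutoff, Real.smoothTransition.one_of_one_le h1,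
    Real.smoothTransition.one_of_one_le h2]
  ring

/-- A continuous function on `[-1, 1]` with an integrable weak derivative satisfies the
fundamental theorem of calculus. -/
theorem integral_weakDeriv_eq_sub {H G : ℝ → ℝ} (hH : Continuous H)
    (hG : IntegrableOn G (Set.Ioo (-1) 1))
    (hw : ∀ χ : ℝ → ℝ, ContDiff ℝ ∞ χ → HasCompactSupport χ → tsupport χ ⊆ Set.Ioo (-1) 1 →
      ∫ t in Set.Ioo (-1 : ℝ) 1, H t * deriv χ t = -∫ t in Set.Ioo (-1 : ℝ) 1, G t * χ t) :
    ∫ t in Set.Ioo (-1 : ℝ) 1, G t = H 1 - H (-1) := by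
  have hcut : ∀ n : ℕ, ∫ t in Set.Ioo (-1 : ℝ) 1, H t * deriv (intervalCutoff n) t =
      -∫ t in Set.Ioo (-1 : ℝ) 1, G t * intervalCutoff n t := fun n => by
    refine hw _ (contDiff_intervalCutoff n)
      (HasCompactSupport.intro isCompact_Icc fun _ ht => intervalCutoff_eq_zero n ht)
      ((tsupport_intervalCutoff_subset n).trans ?_)
    have : 0 < 1 / ((n : ℝ) + 2) := by positivity
    exact fun t ht => ⟨by linarith [ht.1], by linarith [ht.2]⟩
  have hR : Tendsto (fun n => -∫ t in Set.Ioo (-1 : ℝ) 1, G t * intervalCutoff n t) atTop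
      (𝓝 (-∫ t in Set.Ioo (-1 : ℝ) 1, G t)) := by
    refine (tendsto_integral_of_dominated_convergence (fun t => ‖G t‖) (fun n => ?_) hG.norm
      (fun n => .of_forall fun t => ?_) ?_).neg
    · exact hG.aestronglyMeasurable.mul
        (contDiff_intervalCutoff n).continuous.aestronglyMeasurable
    · rw [norm_mul]
      exact mul_le_of_le_one_right (norm_nonneg _) (abs_intervalCutoff_le n t)
    · rw [ae_restrict_iff' measurableSet_Ioo]
      refine .of_forall fun t ht => ?_
      simpa using (tendsto_intervalCutoff ht).const_mul (G t)
  -- The derivative of the cutoff is a unit mass approaching $-1$ minus one approaching $1$; the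
  -- latter is treated by reflecting `H`.
  have hL : Tendsto (fun n => ∫ t in Set.Ioo (-1 : ℝ) 1, H t * deriv (intervalCutoff n) t) atTop
      (𝓝 (H (-1) - H 1)) := by
    have h1 := tendsto_integral_mul_deriv_smoothTransition hH
    have h2 := tendsto_integral_mul_deriv_smoothTransition (hH.comp continuous_neg)
    simp only [Function.comp_apply, neg_neg] at h2
    refine (h1.sub h2).congr fun n => ?_
    have e : ∫ t in (-1 : ℝ)..1,
        H (-t) * ((n + 2) * deriv Real.smoothTransition ((n + 2) * t + (n + 1))) =
        ∫ t in (-1 : ℝ)..1,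
        H t * ((n + 2) * deriv Real.smoothTransition ((n + 2) * (-t) + (n + 1))) := by
      have := intervalIntegral.integral_comp_neg (a := -1) (b := 1) fun t : ℝ =>
        H t * ((n + 2) * deriv Real.smoothTransition ((n + 2) * (-t) + (n + 1)))
      simpa using this
    rw [e, ← intervalIntegral.integral_sub, ← integral_Ioc_eq_integral_Ioo,
      intervalIntegral.integral_of_le (by norm_num)]
    · simp only [deriv_intervalCutoff, mul_sub]
    · exact (hH.mul (continuous_const.mul
        (continuous_deriv_smoothTransition.comp (by fun_prop)))).intervalIntegrable _ _
    · exact (hH.mul (continuous_const.mul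
        (continuous_deriv_smoothTransition.comp (by fun_prop)))).intervalIntegrable _ _
  have := tendsto_nhds_unique (hL.congr hcut) hR
  linarith

/-! ### Integration over rectangles -/

/-- The open rectangle `(-1, 1) × (-a, a)`. -/
def rect (a : ℝ) : Set Plane := {x | x 0 ∈ Set.Ioo (-1 : ℝ) 1 ∧ x 1 ∈ Set.Ioo (-a) a}

/-- The identification of `ℝ × ℝ` with the plane. -/
noncomputable def prodPlane : ℝ × ℝ ≃ᵐ Plane :=
  MeasurableEquiv.finTwoArrow.symm.trans (MeasurableEquiv.toLp 2 (Fin 2 → ℝ))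

theorem prodPlane_apply (p : ℝ × ℝ) : prodPlane p = !₂[p.1, p.2] := rfl

theorem measurePreserving_prodPlane : MeasurePreserving prodPlane :=
  (PiLp.volume_preserving_toLp (Fin 2)).comp (volume_preserving_finTwoArrow ℝ).symm

theorem continuous_prodPlane : Continuous prodPlane := by
  have : Continuous fun p : ℝ × ℝ => (!₂[p.1, p.2] : Plane) := by fun_prop
  exact this

theorem prodPlane_preimage_rect (a : ℝ) :
    prodPlane ⁻¹' rect a = Set.Ioo (-1 : ℝ) 1 ×ˢ Set.Ioo (-a) a := by
  ext p
  simp [rect, prodPlane_apply]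

theorem integrableOn_prodPlane {a : ℝ} {F : Plane → ℝ} (hF : IntegrableOn F (rect a)) :
    IntegrableOn (fun p : ℝ × ℝ => F !₂[p.1, p.2]) (Set.Ioo (-1 : ℝ) 1 ×ˢ Set.Ioo (-a) a) := by
  rw [← prodPlane_preimage_rect]
  exact (measurePreserving_prodPlane.integrableOn_comp_preimage
    prodPlane.measurableEmbedding).2 hF

theorem setIntegral_rect {a : ℝ} {F : Plane → ℝ} (hF : IntegrableOn F (rect a)) :
    ∫ x in rect a, F x =
      ∫ t in Set.Ioo (-1 : ℝ) 1, ∫ y in Set.Ioo (-a) a, F !₂[t, y] := by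
  rw [← measurePreserving_prodPlane.setIntegral_preimage_emb prodPlane.measurableEmbedding,
    prodPlane_preimage_rect]
  exact setIntegral_prod (fun p : ℝ × ℝ => F !₂[p.1, p.2]) (integrableOn_prodPlane hF)

theorem integrableOn_integral_rect {a : ℝ} {F : Plane → ℝ} (hF : IntegrableOn F (rect a)) :
    IntegrableOn (fun t => ∫ y in Set.Ioo (-a) a, F !₂[t, y]) (Set.Ioo (-1 : ℝ) 1) := by
  have h := integrableOn_prodPlane hF
  rw [IntegrableOn, Measure.volume_eq_prod, ← Measure.prod_restrict] at h
  exact h.integral_prod_left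

theorem mem_closure_rect {a : ℝ} (ha : 0 < a) {t y : ℝ} (ht : t ∈ Set.Icc (-1 : ℝ) 1)
    (hy : y ∈ Set.Icc (-a) a) : !₂[t, y] ∈ closure (rect a) := by
  have h1 : (t, y) ∈ closure (Set.Ioo (-1 : ℝ) 1 ×ˢ Set.Ioo (-a) a) := by
    rw [closure_prod_eq, closure_Ioo (by norm_num), closure_Ioo (by linarith)]
    exact ⟨ht, hy⟩
  rw [← prodPlane_preimage_rect] at h1
  exact closure_mono (Set.image_preimage_subset _ _)
    (image_closure_subset_closure_image continuous_prodPlane ⟨_, h1, rfl⟩)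

theorem clamp_mem_Icc {b : ℝ} (hb : 0 ≤ b) (t : ℝ) : max (-b) (min b t) ∈ Set.Icc (-b) b :=
  ⟨le_max_left _ _, max_le (by linarith) (min_le_left _ _)⟩

theorem clamp_eq_self {b t : ℝ} (ht : t ∈ Set.Icc (-b) b) : max (-b) (min b t) = t := by
  rw [min_eq_right ht.2, max_eq_right ht.1]

theorem integrableOn_rect_of_continuousOn {a : ℝ} (ha : 0 < a) {F : Plane → ℝ}
    (hF : ContinuousOn F (closure (rect a))) : IntegrableOn F (rect a) := by
  have hb : rect a ⊆ prodPlane '' (Set.Icc (-1 : ℝ) 1 ×ˢ Set.Icc (-a) a) := fun x hx =>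
    ⟨(x 0, x 1), ⟨⟨hx.1.1.le, hx.1.2.le⟩, ⟨hx.2.1.le, hx.2.2.le⟩⟩, by
      rw [prodPlane_apply]
      ext i
      fin_cases i <;> rfl⟩
  have hK : IsCompact (prodPlane '' (Set.Icc (-1 : ℝ) 1 ×ˢ Set.Icc (-a) a)) :=
    (isCompact_Icc.prod isCompact_Icc).image continuous_prodPlane
  have hKs : prodPlane '' (Set.Icc (-1 : ℝ) 1 ×ˢ Set.Icc (-a) a) ⊆ closure (rect a) := by
    rintro _ ⟨p, hp, rfl⟩
    exact mem_closure_rect ha hp.1 hp.2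
  exact ((hF.mono hKs).integrableOn_compact hK).mono_set hb

/-- The Gauss-Green formula, against a test function of the second variable, in a rectangle. -/
theorem integral_rect_weakPartial {U : Set Plane} {a : ℝ} (ha : 0 < a) (hU : rect a ⊆ U)
    (hUo : IsOpen U) {v g : Plane → ℝ} (hv : ContinuousOn v (closure U))
    (hg : IsWeakPartial U 0 v g) (hgi : IntegrableOn g (rect a)) {ψ : ℝ → ℝ}
    (hψ : ContDiff ℝ ∞ ψ) (hψc : HasCompactSupport ψ) (hψs : tsupport ψ ⊆ Set.Ioo (-a) a) :
    ∫ x in rect a, g x * ψ (x 1) =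
      (∫ y in Set.Ioo (-a) a, v !₂[1, y] * ψ y) - ∫ y in Set.Ioo (-a) a, v !₂[-1, y] * ψ y := by
  have hcl : ∀ {t y : ℝ}, t ∈ Set.Icc (-1 : ℝ) 1 → y ∈ Set.Icc (-a) a → !₂[t, y] ∈ closure U :=
    fun ht hy => closure_mono hU (mem_closure_rect ha ht hy)
  -- Clamping both coordinates gives a globally continuous extension of `v`, which is only known to
  -- be continuous on `closure U`.
  obtain ⟨V, hV⟩ : ∃ V : ℝ → ℝ → ℝ,
      V = fun t y => v !₂[max (-1) (min 1 t), max (-a) (min a y)] := ⟨_, rfl⟩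
  have hVc : Continuous (Function.uncurry V) := by
    rw [hV]
    refine hv.comp_continuous (f := fun p : ℝ × ℝ =>
      (!₂[max (-1) (min 1 p.1), max (-a) (min a p.2)] : Plane)) (by fun_prop) fun p => ?_
    exact hcl (clamp_mem_Icc zero_le_one _) (clamp_mem_Icc ha.le _)
  have hVe : ∀ {t y : ℝ}, t ∈ Set.Icc (-1 : ℝ) 1 → y ∈ Set.Icc (-a) a → V t y = v !₂[t, y] := by
    intro t y ht hy
    rw [hV]
    beta_reduce
    rw [clamp_eq_self ht, clamp_eq_self hy]
  have hVint : ∀ t ∈ Set.Icc (-1 : ℝ) 1, ∫ y in (-a)..a, V t y * ψ y =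
      ∫ y in Set.Ioo (-a) a, v !₂[t, y] * ψ y := by
    intro t ht
    rw [intervalIntegral.integral_of_le (by linarith), integral_Ioc_eq_integral_Ioo]
    refine setIntegral_congr_fun measurableSet_Ioo fun y hy => ?_
    rw [hVe ht (Set.Ioo_subset_Icc_self hy)]
  have hHc : Continuous fun t => ∫ y in (-a)..a, V t y * ψ y := by
    refine intervalIntegral.continuous_parametric_intervalIntegral_of_continuous' ?_ _ _
    exact hVc.mul (hψ.continuous.comp continuous_snd)
  obtain ⟨Bψ, hBψ⟩ := hψc.exists_bound_of_continuous hψ.continuous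
  have hgψ : IntegrableOn (fun x => g x * ψ (x 1)) (rect a) :=
    hgi.mul_bdd (c := Bψ) (hψ.continuous.comp (by fun_prop)).aestronglyMeasurable
      (.of_forall fun x => hBψ _)
  -- The slice integral $t\mapsto\int V(t,y)\psi(y)\,dy$ has weak derivative $\int
  -- g(t,y)\psi(y)\,dy$; this is checked below with product test functions $\chi(x_1)\psi(x_2)$.
  have key := integral_weakDeriv_eq_sub hHc (integrableOn_integral_rect hgψ) ?_
  · rw [hVint 1 (by simp), hVint (-1) (by simp)] at key
    rw [setIntegral_rect hgψ]
    exact key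
  intro χ hχ hχc hχs
  have hΦ : ContDiff ℝ ∞ fun x : Plane => χ (x 0) * ψ (x 1) :=
    (hχ.comp (by fun_prop)).mul (hψ.comp (by fun_prop))
  have hK : IsCompact (prodPlane '' (tsupport χ ×ˢ tsupport ψ)) :=
    (hχc.isCompact.prod hψc.isCompact).image continuous_prodPlane
  have hsupp : Function.support (fun x : Plane => χ (x 0) * ψ (x 1)) ⊆
      prodPlane '' (tsupport χ ×ˢ tsupport ψ) := fun x hx =>
    ⟨(x 0, x 1), ⟨subset_tsupport χ (left_ne_zero_of_mul hx),
      subset_tsupport ψ (right_ne_zero_of_mul hx)⟩, by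
      rw [prodPlane_apply]
      ext i
      fin_cases i <;> rfl⟩
  have hts : tsupport (fun x : Plane => χ (x 0) * ψ (x 1)) ⊆ rect a := by
    refine (closure_minimal hsupp hK.isClosed).trans ?_
    rintro _ ⟨p, hp, rfl⟩
    exact ⟨hχs hp.1, hψs hp.2⟩
  have hder : ∀ x : Plane, fderiv ℝ (fun x : Plane => χ (x 0) * ψ (x 1)) x
      (EuclideanSpace.single 0 1) = deriv χ (x 0) * ψ (x 1) := by
    intro x
    have h0 : HasFDerivAt (fun x : Plane => x 0) (EuclideanSpace.proj (𝕜 := ℝ) (0 : Fin 2)) x :=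
      (EuclideanSpace.proj (𝕜 := ℝ) (0 : Fin 2)).hasFDerivAt
    have h1 : HasFDerivAt (fun x : Plane => x 1) (EuclideanSpace.proj (𝕜 := ℝ) (1 : Fin 2)) x :=
      (EuclideanSpace.proj (𝕜 := ℝ) (1 : Fin 2)).hasFDerivAt
    have hχ' := ((hχ.differentiable (by simp)) (x 0)).hasDerivAt.comp_hasFDerivAt x h0
    have hψ' := ((hψ.differentiable (by simp)) (x 1)).hasDerivAt.comp_hasFDerivAt x h1
    have := (hχ'.mul hψ').fderiv
    change fderiv ℝ (fun x : Plane => χ (x 0) * ψ (x 1)) x = _ at this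
    rw [this]
    simp
    ring
  have hzero : ∀ x ∉ rect a, χ (x 0) * ψ (x 1) = 0 := fun x hx =>
    image_eq_zero_of_notMem_tsupport (f := fun x : Plane => χ (x 0) * ψ (x 1))
      fun h => hx (hts h)
  have hzero' : ∀ x ∉ rect a, deriv χ (x 0) * ψ (x 1) = 0 := fun x hx => by
    have : fderiv ℝ (fun x : Plane => χ (x 0) * ψ (x 1)) x = 0 :=
      image_eq_zero_of_notMem_tsupport fun h => hx (hts (tsupport_fderiv_subset ℝ h))
    rw [← hder, this]
    rfl
  have hweak := hg.2.2 _ hΦ (HasCompactSupport.of_support_subset_isCompact hK hsupp)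
    (hts.trans hU)
  simp only [hder] at hweak
  rw [setIntegral_eq_of_subset_of_forall_sdiff_eq_zero hUo.measurableSet hU
      fun x hx => by rw [hzero' x hx.2, mul_zero],
    setIntegral_eq_of_subset_of_forall_sdiff_eq_zero hUo.measurableSet hU
      fun x hx => by rw [hzero x hx.2, mul_zero]] at hweak
  obtain ⟨Bχ, hBχ⟩ := hχc.exists_bound_of_continuous hχ.continuous
  have hi1 : IntegrableOn (fun x => v x * (deriv χ (x 0) * ψ (x 1))) (rect a) := by
    refine integrableOn_rect_of_continuousOn ha ((hv.mono (closure_mono hU)).mul ?_)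
    have hd : Continuous (deriv χ) := hχ.continuous_deriv (by simp)
    exact ((hd.comp (by fun_prop)).mul (hψ.continuous.comp (by fun_prop))).continuousOn
  have hi2 : IntegrableOn (fun x => g x * (χ (x 0) * ψ (x 1))) (rect a) := by
    have := hgψ.mul_bdd (c := Bχ) (g := fun x : Plane => χ (x 0))
      (hχ.continuous.comp (by fun_prop)).aestronglyMeasurable (.of_forall fun x => hBχ _)
    refine this.congr (.of_forall fun x => ?_)
    beta_reduce
    ring
  rw [setIntegral_rect hi1, setIntegral_rect hi2] at hweak
  calc _ = ∫ t in Set.Ioo (-1 : ℝ) 1, ∫ y in Set.Ioo (-a) a,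
        v !₂[t, y] * (deriv χ t * ψ y) := by
        refine setIntegral_congr_fun measurableSet_Ioo fun t ht => ?_
        rw [hVint t (Set.Ioo_subset_Icc_self ht), ← integral_mul_const]
        congr 1
        ext y
        ring
    _ = -∫ t in Set.Ioo (-1 : ℝ) 1, ∫ y in Set.Ioo (-a) a, g !₂[t, y] * (χ t * ψ y) := hweak
    _ = _ := by
        congr 1
        refine integral_congr_ae (.of_forall fun t => ?_)
        beta_reduce
        rw [← integral_mul_const]
        congr 1
        ext y
        simp
        ring

/-! ### The lower bound for vector fields -/

/-- On a finite measure space $L^2$ convergence implies $L^1$ convergence, and a weight bounded by 1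
does no harm. -/
theorem tendsto_integral_mul_of_eLpNorm_two {α : Type*} [MeasurableSpace α] {μ : Measure α}
    [IsFiniteMeasure μ] {f : ℕ → α → ℝ} {w : α → ℝ} (hf : ∀ k, AEStronglyMeasurable (f k) μ)
    (hw : AEStronglyMeasurable w μ) (hw1 : ∀ x, |w x| ≤ 1)
    (h : Tendsto (fun k => eLpNorm (f k) 2 μ) atTop (𝓝 0)) :
    Tendsto (fun k => ∫ x, f k x * w x ∂μ) atTop (𝓝 0) := by
  have hle : ∀ k, eLpNorm (fun x => f k x * w x) 1 μ ≤
      eLpNorm (f k) 2 μ * μ Set.univ ^ (1 / (1 : ENNReal).toReal - 1 / (2 : ENNReal).toReal) := by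
    intro k
    refine (eLpNorm_mono (g := f k) fun x => ?_).trans
      (eLpNorm_le_eLpNorm_mul_rpow_measure_univ (by norm_num) (hf k))
    rw [norm_mul]
    exact mul_le_of_le_one_right (norm_nonneg _) (hw1 x)
  have hC : μ Set.univ ^ (1 / (1 : ENNReal).toReal - 1 / (2 : ENNReal).toReal) ≠ ⊤ :=
    ENNReal.rpow_ne_top_of_nonneg (by norm_num) (measure_ne_top _ _)
  have hlim : Tendsto (fun k => eLpNorm (fun x => f k x * w x) 1 μ) atTop (𝓝 0) := by
    have := ENNReal.Tendsto.mul_const h (Or.inr hC)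
    rw [zero_mul] at this
    exact tendsto_of_tendsto_of_tendsto_of_le_of_le tendsto_const_nhds this
      (fun _ => zero_le) hle
  -- Only eventually, because the first few norms may be infinite.
  have hint : ∀ᶠ k in atTop, Integrable (fun x => f k x * w x) μ := by
    filter_upwards [hlim.eventually_lt_const ENNReal.zero_lt_top] with k hk
    exact memLp_one_iff_integrable.1 ⟨(hf k).mul hw, hk⟩
  have := tendsto_integral_of_L1' (μ := μ) (fun _ => (0 : ℝ)) aestronglyMeasurable_const hint
    (hlim.congr fun k => by congr 1; ext x; simp)
  simpa using this

theorem isometry_vertical (e : ℝ) : Isometry fun y : ℝ => (!₂[e, y] : Plane) := by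
  refine Isometry.of_dist_eq fun x y => ?_
  rw [EuclideanSpace.dist_eq, Fin.sum_univ_two]
  simp [Real.dist_eq, Real.sqrt_sq_eq_abs]

/-- A vertical line is isometrically embedded, so Lebesgue measure on it is one-dimensional
Hausdorff measure; convergence on `Γ` thus passes to the straight sides. -/
theorem eLpNorm_vertical_le {Γ : Set Plane} {S : Set ℝ} (hΓ : MeasurableSet Γ) {e : ℝ}
    (h : ∀ y ∈ S, !₂[e, y] ∈ Γ) (f : Plane → ℝ) :
    eLpNorm (fun y => f !₂[e, y]) 2 (volume.restrict S) ≤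
      eLpNorm f 2 ((Measure.hausdorffMeasure 1).restrict Γ) := by
  have hemb : MeasurableEmbedding fun y : ℝ => (!₂[e, y] : Plane) :=
    (isometry_vertical e).isClosedEmbedding.measurableEmbedding
  have h1 : eLpNorm (fun y => f !₂[e, y]) 2 (volume.restrict S) =
      eLpNorm f 2 (Measure.map (fun y : ℝ => (!₂[e, y] : Plane)) (volume.restrict S)) :=
    hemb.eLpNorm_map_measure.symm
  rw [h1]
  refine eLpNorm_mono_measure f ?_
  calc Measure.map (fun y : ℝ => (!₂[e, y] : Plane)) (volume.restrict S)
      ≤ Measure.map (fun y : ℝ => (!₂[e, y] : Plane))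
        (volume.restrict ((fun y : ℝ => (!₂[e, y] : Plane)) ⁻¹' Γ)) :=
        Measure.map_mono (Measure.restrict_mono h le_rfl) hemb.measurable
    _ = (Measure.map (fun y : ℝ => (!₂[e, y] : Plane)) volume).restrict Γ :=
        (Measure.restrict_map hemb.measurable hΓ).symm
    _ ≤ _ := by
        rw [← hausdorffMeasure_real, (isometry_vertical e).map_hausdorffMeasure (by simp)]
        exact Measure.restrict_mono_measure Measure.restrict_le_self _

/-- Gauss-Green holds for the approximations `v k`, continuous up to the boundary. The interior term
converges with the weak derivatives and the side terms with the traces. -/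
theorem integral_rect_of_hasTrace {U Γ : Set Plane} {a : ℝ} (ha : 0 < a) (hU : rect a ⊆ U)
    (hUo : IsOpen U) (hfin : volume U ≠ ⊤) (hΓ : MeasurableSet Γ)
    (hΓr : ∀ y ∈ Set.Ioo (-a) a, !₂[1, y] ∈ Γ) (hΓl : ∀ y ∈ Set.Ioo (-a) a, !₂[-1, y] ∈ Γ)
    {u φ : Plane → ℝ} (hu : MemW12 U u) (htr : HasTrace U Γ u φ) {c d : ℝ}
    (hc : ∀ y, φ !₂[1, y] = c) (hd : ∀ y, φ !₂[-1, y] = d) {ψ : ℝ → ℝ}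
    (hψ : ContDiff ℝ ∞ ψ) (hψc : HasCompactSupport ψ) (hψs : tsupport ψ ⊆ Set.Ioo (-a) a)
    (hψ1 : ∀ y, |ψ y| ≤ 1) :
    ∫ x in rect a, weakPartial U 0 u x * ψ (x 1) = (c - d) * ∫ y in Set.Ioo (-a) a, ψ y := by
  obtain ⟨v, hv, ⟨-, hv1⟩, hv2⟩ := htr
  have hfinU : IsFiniteMeasure (volume.restrict U) := ⟨by simpa using hfin.lt_top⟩
  have hfinR : IsFiniteMeasure (volume.restrict (rect a)) :=
    ⟨by simpa using (measure_mono hU).trans_lt hfin.lt_top⟩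
  have hwp : ∀ k, IsWeakPartial U 0 (v k - u) (weakPartial U 0 (v k - u)) := fun k => by
    have := (((hv k).1.isWeakPartial 0).add (hu.isWeakPartial 0).neg)
    rw [← sub_eq_add_neg] at this
    exact isWeakPartial_weakPartial this
  have hwm : ∀ k, MemLp (weakPartial U 0 (v k - u)) 2 (volume.restrict U) := fun k => by
    have h1 := ((hv k).1.isWeakPartial 0).add (hu.isWeakPartial 0).neg
    rw [← sub_eq_add_neg] at h1
    exact (((hv k).1.memLp_weakPartial hUo 0).add (hu.memLp_weakPartial hUo 0).neg).ae_eq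
      (h1.weakPartial_ae_eq hUo).symm
  have hψm : AEStronglyMeasurable (fun x : Plane => ψ (x 1)) (volume.restrict (rect a)) :=
    (hψ.continuous.comp (by fun_prop)).aestronglyMeasurable
  have hui : IntegrableOn (weakPartial U 0 u) (rect a) :=
    IntegrableOn.mono_set ((hu.memLp_weakPartial hUo 0).integrable (by norm_num)) hU
  have hki : ∀ k, IntegrableOn (weakPartial U 0 (v k - u)) (rect a) := fun k =>
    IntegrableOn.mono_set ((hwm k).integrable (by norm_num)) hU
  have hmul : ∀ {f : Plane → ℝ}, IntegrableOn f (rect a) →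
      IntegrableOn (fun x => f x * ψ (x 1)) (rect a) := fun hf =>
    hf.mul_bdd (c := 1) hψm (.of_forall fun x => hψ1 _)
  have hvert : ∀ k, ∀ e ∈ Set.Icc (-1 : ℝ) 1,
      IntegrableOn (fun y => v k !₂[e, y]) (Set.Ioo (-a) a) := fun k e he => by
    have : ContinuousOn (fun y : ℝ => v k !₂[e, y]) (Set.Icc (-a) a) :=
      (hv k).2.comp (isometry_vertical e).continuous.continuousOn fun y hy =>
        closure_mono hU (mem_closure_rect ha he hy)
    exact this.integrableOn_Icc.mono_set Set.Ioo_subset_Icc_self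
  have hmul' : ∀ {f : ℝ → ℝ}, IntegrableOn f (Set.Ioo (-a) a) →
      IntegrableOn (fun y => f y * ψ y) (Set.Ioo (-a) a) := fun hf =>
    hf.mul_bdd (c := 1) hψ.continuous.aestronglyMeasurable (.of_forall fun x => hψ1 _)
  have hside : ∀ e ∈ Set.Icc (-1 : ℝ) 1, ∀ b : ℝ, (∀ y ∈ Set.Ioo (-a) a, !₂[e, y] ∈ Γ) →
      (∀ y, φ !₂[e, y] = b) →
      Tendsto (fun k => ∫ y in Set.Ioo (-a) a, v k !₂[e, y] * ψ y) atTop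
        (𝓝 (b * ∫ y in Set.Ioo (-a) a, ψ y)) := by
    intro e he b heΓ hb
    have hn : Tendsto (fun k => eLpNorm (fun y => v k !₂[e, y] - b) 2
        (volume.restrict (Set.Ioo (-a) a))) atTop (𝓝 0) := by
      refine tendsto_of_tendsto_of_tendsto_of_le_of_le tendsto_const_nhds hv2
        (fun _ => zero_le) fun k => ?_
      have := eLpNorm_vertical_le hΓ heΓ (v k - φ)
      simpa only [Pi.sub_apply, hb] using this
    have h0 := tendsto_integral_mul_of_eLpNorm_two (w := ψ)
      (fun k => (hvert k e he).aestronglyMeasurable.sub aestronglyMeasurable_const)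
      hψ.continuous.aestronglyMeasurable hψ1 hn
    have := h0.add_const (b * ∫ y in Set.Ioo (-a) a, ψ y)
    rw [zero_add] at this
    refine this.congr fun k => ?_
    have hic : IntegrableOn (fun _ : ℝ => b) (Set.Ioo (-a) a) := integrable_const b
    rw [← integral_const_mul, ← integral_add (hmul' ((hvert k e he).sub hic)) (hmul' hic)]
    congr 1
    ext y
    simp only [Pi.sub_apply]
    ring
  have hpart := tendsto_integral_mul_of_eLpNorm_two (w := fun x : Plane => ψ (x 1))
    (fun k => (hki k).aestronglyMeasurable) hψm (fun x => hψ1 _)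
    (tendsto_of_tendsto_of_tendsto_of_le_of_le tendsto_const_nhds (hv1 0) (fun _ => zero_le)
      fun k => eLpNorm_mono_measure _ (Measure.restrict_mono hU le_rfl))
  -- The derivative of `v k` is represented by that of `v k - u` plus that of `u`, since convergence
  -- is given for the former.
  have hgreen : ∀ k, (∫ x in rect a, weakPartial U 0 (v k - u) x * ψ (x 1)) +
      ∫ x in rect a, weakPartial U 0 u x * ψ (x 1) =
      (∫ y in Set.Ioo (-a) a, v k !₂[1, y] * ψ y) -
        ∫ y in Set.Ioo (-a) a, v k !₂[-1, y] * ψ y := by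
    intro k
    have h1 := (hwp k).add (hu.isWeakPartial 0)
    rw [sub_add_cancel] at h1
    rw [← integral_rect_weakPartial ha hU hUo (hv k).2 h1 ((hki k).add hui) hψ hψc hψs,
      ← integral_add (hmul (hki k)) (hmul hui)]
    simp only [Pi.add_apply, add_mul]
  have hl := hpart.add_const (∫ x in rect a, weakPartial U 0 u x * ψ (x 1))
  have hr := (hside 1 (by simp) c hΓr hc).sub (hside (-1) (by simp) d hΓl hd)
  have := tendsto_nhds_unique (hl.congr hgreen) hr
  linarith

/-- Heights below $\delta-1$ in absolute value are more than 1 away from the centres of the holes.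
-/
theorem rect_subset_stadium (δ : ℝ) : rect (δ - 1) ⊆ stadium δ := by
  rintro x ⟨⟨h1, h2⟩, h3, h4⟩
  refine ⟨Or.inr ⟨abs_lt.2 ⟨h1, h2⟩, abs_le.2 ⟨by linarith, by linarith⟩⟩, ?_⟩
  simp only [Set.mem_union, M₄, M₅, Set.mem_ofPred_eq, not_or, not_le]
  constructor <;> nlinarith [sq_nonneg (x 0)]

theorem vertical_mem_outerBoundary {δ e y : ℝ} (hδ : 1 < δ) (he : e = 1 ∨ e = -1)
    (hy : y ∈ Set.Ioo (-(δ - 1)) (δ - 1)) : !₂[e, y] ∈ outerBoundary δ := by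
  have hy' : |(!₂[e, y] : Plane) 1| ≤ δ := abs_le.2 ⟨by simp; linarith [hy.1], by
    simp; linarith [hy.2]⟩
  rw [outerBoundary, (isOpen_fullStadium hδ).frontier_eq]
  constructor
  · refine closure_mono ((rect_subset_stadium δ).trans Set.sdiff_subset)
      (mem_closure_rect (by linarith) ?_ (Set.Ioo_subset_Icc_self hy))
    rcases he with rfl | rfl <;> simp
  · rw [fullStadium_eq hδ]
    have : radius δ !₂[e, y] = 1 := by
      rw [radius, height_eq_zero hy']
      rcases he with rfl | rfl <;> simp
    simp [this]

theorem dirichlet_tangentVectorFields_ge {δ σ : ℝ} (hδ : 1 < δ) (hσ : σ = 1 ∨ σ = -1)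
    {n : Plane → Plane} (hn : n ∈ tangentVectorFields δ σ) :
    2 * (δ - 1) ≤ dirichlet (stadium δ) fun x (a : Fin 2) => n x a := by
  obtain ⟨hW, -, hT⟩ := hn
  have hUo := isOpen_stadium hδ
  have hU := rect_subset_stadium δ
  have ha : 0 < δ - 1 := by linarith
  have hσ2 : σ ^ 2 = 1 := by rcases hσ with rfl | rfl <;> simp
  -- Equality to 1 on an interval of length $\delta-1$ gives $\int\psi\ge\delta-1$. The outer radius
  -- only has to lie strictly between the inner one and $\delta-1$.
  obtain ⟨ψ, hψ⟩ : ∃ ψ : ContDiffBump (0 : ℝ), ψ.rIn = (δ - 1) / 2 ∧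
      ψ.rOut = 3 * (δ - 1) / 4 :=
    ⟨⟨(δ - 1) / 2, 3 * (δ - 1) / 4, by linarith, by linarith⟩, rfl, rfl⟩
  have hψs : tsupport ψ ⊆ Set.Ioo (-(δ - 1)) (δ - 1) := by
    rw [ψ.tsupport_eq, hψ.2, Real.closedBall_eq_Icc]
    exact fun y hy => ⟨by linarith [hy.1], by linarith [hy.2]⟩
  have hψ1 : ∀ y, |ψ y| ≤ 1 := fun y => by
    rw [abs_of_nonneg ψ.nonneg]
    exact ψ.le_one
  set g := weakPartial (stadium δ) 0 fun x => n x 1 with hg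
  have hgreen : ∫ x in rect (δ - 1), g x * ψ (x 1) =
      (-σ - σ) * ∫ y in Set.Ioo (-(δ - 1)) (δ - 1), ψ y :=
    integral_rect_of_hasTrace ha hU hUo (volume_stadium_ne_top hδ)
      isClosed_frontier.measurableSet
      (fun y hy => vertical_mem_outerBoundary hδ (Or.inl rfl) hy)
      (fun y hy => vertical_mem_outerBoundary hδ (Or.inr rfl) hy) (hW 1) (hT 1)
      (fun y => by simp [clockwiseTangent]) (fun y => by simp [clockwiseTangent]) ψ.contDiff
      ψ.hasCompactSupport hψs hψ1
  have hg2 : ∀ (a i : Fin 2), IntegrableOn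
      (fun x => weakPartial (stadium δ) i (fun x => n x a) x ^ 2) (stadium δ) := fun a i =>
    ((hW a).memLp_weakPartial hUo i).integrable_sq
  have hfinU : IsFiniteMeasure (volume.restrict (stadium δ)) :=
    ⟨by simpa using (volume_stadium_ne_top hδ).lt_top⟩
  have hgi : IntegrableOn g (rect (δ - 1)) :=
    IntegrableOn.mono_set (((hW 1).memLp_weakPartial hUo 0).integrable (by norm_num)) hU
  have hψi : IntegrableOn (fun x : Plane => ψ (x 1)) (rect (δ - 1)) :=
    integrableOn_rect_of_continuousOn ha
      (ψ.continuous.comp (by fun_prop : Continuous fun x : Plane => x 1)).continuousOn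
  have hgψ : IntegrableOn (fun x => g x * ψ (x 1)) (rect (δ - 1)) :=
    hgi.mul_bdd (c := 1) (ψ.continuous.comp
      (by fun_prop : Continuous fun x : Plane => x 1)).aestronglyMeasurable
      (.of_forall fun x => hψ1 _)
  have hψrect : ∫ x in rect (δ - 1), ψ (x 1) =
      2 * ∫ y in Set.Ioo (-(δ - 1)) (δ - 1), ψ y := by
    rw [setIntegral_rect hψi]
    simp
    norm_num
  have hψge : δ - 1 ≤ ∫ y in Set.Ioo (-(δ - 1)) (δ - 1), ψ y := by
    have hsub : Set.Icc (-((δ - 1) / 2)) ((δ - 1) / 2) ⊆ Set.Ioo (-(δ - 1)) (δ - 1) :=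
      fun y hy => ⟨by linarith [hy.1], by linarith [hy.2]⟩
    have h1 : ∫ y in Set.Icc (-((δ - 1) / 2)) ((δ - 1) / 2), ψ y = δ - 1 := by
      have : ∫ y in Set.Icc (-((δ - 1) / 2)) ((δ - 1) / 2), ψ y =
          ∫ y in Set.Icc (-((δ - 1) / 2)) ((δ - 1) / 2), (1 : ℝ) := by
        refine setIntegral_congr_fun measurableSet_Icc fun y hy => ?_
        refine ψ.one_of_mem_closedBall ?_
        rw [hψ.1, Real.closedBall_eq_Icc]
        exact ⟨by linarith [hy.1], by linarith [hy.2]⟩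
      rw [this]
      simp
      exact hδ.le
    calc δ - 1 = _ := h1.symm
      _ ≤ _ := setIntegral_mono_set
          (ψ.continuous.integrable_of_hasCompactSupport ψ.hasCompactSupport).integrableOn
          (.of_forall fun y => ψ.nonneg) hsub.eventuallyLE
  calc 2 * (δ - 1) ≤ 2 * ∫ y in Set.Ioo (-(δ - 1)) (δ - 1), ψ y := by linarith
    -- With $\sigma^2=1$ the right side is $4\int\psi-2\int\psi$, the rectangle having width 2.
    _ = -2 * σ * (∫ x in rect (δ - 1), g x * ψ (x 1)) - ∫ x in rect (δ - 1), ψ (x 1) := by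
        rw [hgreen, hψrect]
        linear_combination (-4 * ∫ y in Set.Ioo (-(δ - 1)) (δ - 1), ψ y) * hσ2
    _ = ∫ x in rect (δ - 1), (-2 * σ * (g x * ψ (x 1)) - ψ (x 1)) := by
        rw [integral_sub (hgψ.const_mul _) hψi, integral_const_mul]
    _ ≤ ∫ x in rect (δ - 1), g x ^ 2 := by
        -- Pointwise this is $\psi(g+\sigma)^2+(1-\psi)g^2\ge0$; the slope $-\sigma$ is the optimal
        -- one on width 2.
        refine integral_mono ((hgψ.const_mul _).sub hψi) ((hg2 1 0).mono_set hU) fun x => ?_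
        have h0 : 0 ≤ ψ (x 1) := ψ.nonneg
        have h1 : ψ (x 1) ≤ 1 := ψ.le_one
        beta_reduce
        nlinarith [mul_nonneg h0 (sq_nonneg (g x + σ)),
          mul_nonneg (sub_nonneg.2 h1) (sq_nonneg (g x))]
    _ ≤ ∫ x in stadium δ, g x ^ 2 :=
        setIntegral_mono_set (hg2 1 0) (.of_forall fun x => sq_nonneg _) hU.eventuallyLE
    _ ≤ _ := by
        refine integral_mono (hg2 1 0)
          (integrable_finsetSum _ fun a _ => integrable_finsetSum _ fun i _ => hg2 a i) fun x => ?_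
        simp only [Fin.sum_univ_two]
        have h00 := sq_nonneg (weakPartial (stadium δ) 0 (fun x => n x 0) x)
        have h01 := sq_nonneg (weakPartial (stadium δ) 1 (fun x => n x 0) x)
        have h11 := sq_nonneg (weakPartial (stadium δ) 1 (fun x => n x 1) x)
        linarith

theorem lineEnergy_nonneg (δ : ℝ) (Q : Plane → Matrix (Fin 3) (Fin 3) ℝ) :
    0 ≤ lineEnergy δ Q :=
  integral_nonneg fun _ => Finset.sum_nonneg fun _ _ => Finset.sum_nonneg fun _ _ => sq_nonneg _

end LineField

/-! ### Comparison of the two infima -/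

theorem mainTheorem8 (s : ℝ) (hs : s ∈ Set.Icc (-(1 / 2) : ℝ) 1) (hs0 : s ≠ 0) :
    ∃ δ₀ : ℝ, 1 < δ₀ ∧ ∀ δ : ℝ, δ₀ < δ → ∀ σ : ℝ, (σ = 1 ∨ σ = -1) →
      (LineField.tangentLineFields s δ).Nonempty ∧
      (LineField.tangentVectorFields δ σ).Nonempty ∧
      sInf (LineField.lineEnergy δ '' LineField.tangentLineFields s δ) <
        sInf (LineField.vectorEnergy s δ '' LineField.tangentVectorFields δ σ) ∧
      ∀ Q ∈ LineField.tangentLineFields s δ,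
        IsMinOn (LineField.lineEnergy δ) (LineField.tangentLineFields s δ) Q →
      ∀ n ∈ LineField.tangentVectorFields δ σ,
        IsMinOn (LineField.vectorEnergy s δ) (LineField.tangentVectorFields δ σ) n →
          LineField.lineEnergy δ Q < LineField.vectorEnergy s δ n := by
  obtain ⟨K, hK⟩ := LineField.exists_lineEnergy_tangentLineField_le s
  have hs2 : 0 < s ^ 2 := by positivity
  have hKs : 0 ≤ |K| / s ^ 2 := by positivity
  -- Any $\delta$ beyond this satisfies $s^2(\delta-1)>|K|$, so the linear lower bound exceeds `K`;
  -- the summand 2 keeps the threshold above 1.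
  refine ⟨2 + |K| / s ^ 2, by linarith, fun δ hδ σ hσ => ?_⟩
  have hδ1 : 1 < δ := by linarith
  have hQ := LineField.tangentLineField_mem hδ1 s
  have hn := LineField.tangentVectorField_mem hδ1 hσ
  have hlow : ∀ n ∈ LineField.tangentVectorFields δ σ,
      4 * s ^ 2 * (δ - 1) ≤ LineField.vectorEnergy s δ n := fun n hn => by
    have h := LineField.dirichlet_tangentVectorFields_ge hδ1 hσ hn
    have := mul_le_mul_of_nonneg_left h (by positivity : 0 ≤ 2 * s ^ 2)
    rw [LineField.vectorEnergy]
    linarith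
  have hgap : K < 4 * s ^ 2 * (δ - 1) := by
    have h1 : |K| / s ^ 2 < δ - 1 := by linarith
    rw [div_lt_iff₀ hs2] at h1
    nlinarith [le_abs_self K, mul_pos hs2 (by linarith : 0 < δ - 1)]
  refine ⟨⟨_, hQ⟩, ⟨_, hn⟩, ?_, fun Q _ hQm n hnm _ => ?_⟩
  · calc sInf (LineField.lineEnergy δ '' LineField.tangentLineFields s δ)
        ≤ LineField.lineEnergy δ (LineField.tangentLineField s δ) :=
          csInf_le ⟨0, by
            rintro _ ⟨Q, -, rfl⟩
            exact LineField.lineEnergy_nonneg δ Q⟩ ⟨_, hQ, rfl⟩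
      _ ≤ K := hK δ hδ1
      _ < 4 * s ^ 2 * (δ - 1) := hgap
      _ ≤ _ := le_csInf (Set.Nonempty.image _ ⟨_, hn⟩) (by
          rintro _ ⟨n, hn, rfl⟩
          exact hlow n hn)
  · exact (((hQm hQ).trans (hK δ hδ1)).trans_lt hgap).trans_le (hlow n hnm)
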